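/- Let $G$ be a finite, nonempty, undirected multigraph without loops (parallel edges are allowed). For distinct vertices $u,v$ let $\mu_G(u,v)$ be the number of edges joining $u$ and $v$, and let $\mu_G(v)=\max\{\mu_G(u,v):u\in V(G)\setminus\{v\}\}$ (with $\mu_G(v)=0$ if $v$ is the only vertex). For $X\subseteq V(G)$ and $v\in V(G)$ let $d_X(v)$ be the number of edges between $v$ and $X\setminus\{v\}$, and let $d_G(v)=d_{V(G)}(v)$. Triangles and quadrilaterals are the cycles of length $3$ and $4$ (not necessarily induced) of the underlying simple graph of $G$; that is, two cycles that differ only in the choice of parallel edges are regarded as the same. Suppose that no quadrilateral of $G$ shares an edge with a triangle or with another quadrilateral, and let $a,b:V(G)\to\mathbb{N}\setminus\{0,1\}$ be two functions. If $$d_G(x)\ge a(x)+b(x)+2\mu_G(x)-3\qquad\text{for every }x\in V(G),$$ then $V(G)$ is the union of two disjoint nonempty sets $X$ and $Y$ such that $d_X(x)\ge a(x)$ for every $x\in X$ and $d_Y(y)\ge b(y)$ for every $y\in Y$. -/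

import Mathlib

/-!
Multigraphs are Mathlib's `Graph α β`, with vertex set `V(G)`, edge set `E(G)`, and `G.IsLink e u v`
for "the edge `e` joins `u` and `v`".
-/

open scoped Graph

namespace Graph

variable {α β : Type*}

/-- `d_X(v)`: the number of edges between `v` and `X \ {v}`. -/
noncomputable def degIn (G : Graph α β) (X : Set α) (v : α) : ℕ :=
  {e | ∃ u ∈ X \ {v}, G.IsLink e v u}.ncard

/-- `μ_G(u, v)`: the number of edges joining `u` and `v`. -/
noncomputable def multiplicity (G : Graph α β) (u v : α) : ℕ :=
  {e | G.IsLink e u v}.ncard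

/-- `μ_G(v)`: the largest multiplicity `μ_G(u, v)` with `u ∈ V(G) \ {v}`
(a maximum over a finite set; `0` if `v` is the only vertex). -/
noncomputable def weight (G : Graph α β) (v : α) : ℕ :=
  sSup ((fun u => G.multiplicity u v) '' (V(G) \ {v}))

/-- `T` is the set of vertex pairs joined along some triangle of `G`. -/
def IsTriangle (G : Graph α β) (T : Set (Sym2 α)) : Prop :=
  ∃ x y z : α, [x, y, z].Nodup ∧ G.Adj x y ∧ G.Adj y z ∧ G.Adj z x ∧
    T = {s(x, y), s(y, z), s(z, x)}

/-- `Q` is the set of vertex pairs joined along some quadrilateral (4-cycle, not necessarily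
induced) of `G`. Replacing an edge by a parallel one does not change the quadrilateral. -/
def IsQuadrilateral (G : Graph α β) (Q : Set (Sym2 α)) : Prop :=
  ∃ w x y z : α, [w, x, y, z].Nodup ∧ G.Adj w x ∧ G.Adj x y ∧ G.Adj y z ∧ G.Adj z w ∧
    Q = {s(w, x), s(x, y), s(y, z), s(z, w)}

/-- No quadrilateral of `G` shares an edge with a triangle or with another quadrilateral. -/
def QuadrilateralsShareNoEdges (G : Graph α β) : Prop :=
  ∀ Q, G.IsQuadrilateral Q →
    (∀ T, G.IsTriangle T → Disjoint Q T) ∧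
    (∀ Q', G.IsQuadrilateral Q' → Q' ≠ Q → Disjoint Q Q')

/-- `(X, Y)` is a partition of `V(G)` into two nonempty sets such that `d_X(x) ≥ a(x)` for
`x ∈ X` and `d_Y(y) ≥ b(y)` for `y ∈ Y`. -/
structure IsFeasiblePartition (G : Graph α β) (a b : α → ℕ) (X Y : Set α) : Prop where
  left_nonempty : X.Nonempty
  right_nonempty : Y.Nonempty
  disjoint : Disjoint X Y
  union_eq : X ∪ Y = V(G)
  left_feasible : ∀ x ∈ X, a x ≤ G.degIn X x
  right_feasible : ∀ y ∈ Y, b y ≤ G.degIn Y y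

end Graph

/-!
Suppose that no two disjoint nonempty sets are feasible for `a` and `b`. Then one of any two
disjoint sets is degenerate, that is, contains no nonempty feasible subset, and there is a partition
of the vertices into degenerate sets `A`, `B` and a single centre `x`. Choose one of maximum
potential, the number of edges inside `A` and `B` minus the sums of `a` over `A` and of `b` over
`B`, up to a penalty for low degrees at `x`. Comparing it with the partitions obtained by moving one
or two vertices produces a star: a centre adjacent to all vertices that are low (of degree less than
`a`, respectively `b`) in their part, of which there are at least three. In a star with the most low
vertices the centre `x` forms a triangle with low vertices `z` of `A` and `y` of `B`; moving the
centre to `y` and to `z` shows that each corner of this triangle has a pendant neighbour. All ways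
of distributing these six vertices over the rest of the partition again have maximum potential, and
this forces a vertex on each side of the rest to be adjacent to all three pendants. The three
quadrilaterals so formed share edges.
-/

/-- A loopless multigraph, given as a simple graph with edge multiplicities. The multiplicities are
integers so that degrees can be subtracted without truncation. -/
structure Multigraph (V : Type*) extends SimpleGraph V where
  mult : V → V → ℤ
  mult_comm : ∀ u v, mult u v = mult v u
  mult_nonneg : ∀ u v, 0 ≤ mult u v
  mult_pos_iff : ∀ {u v}, 0 < mult u v ↔ Adj u v

namespace Multigraph

variable {V : Type*}

section QuadsEdgeDisjoint

variable {G : SimpleGraph V} {p q r u v w x y z : V}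

/-- `x y z w` is a 4-cycle, not necessarily induced, of the simple graph `G`. -/
structure IsQuad (G : SimpleGraph V) (x y z w : V) : Prop where
  adj_xy : G.Adj x y
  adj_yz : G.Adj y z
  adj_zw : G.Adj z w
  adj_wx : G.Adj w x
  ne_xz : x ≠ z
  ne_yw : y ≠ w

/-- No 4-cycle of `G` shares an edge with a triangle or with another 4-cycle. Both clauses name the
shared edge `x y`, so that the second says that at most one 4-cycle passes through it. -/
structure QuadsEdgeDisjoint (G : SimpleGraph V) : Prop where
  not_triangle : ∀ {x y z w t : V}, IsQuad G x y z w → G.Adj x t → ¬ G.Adj y t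
  unique : ∀ {x y z w z' w' : V}, IsQuad G x y z w → IsQuad G x y z' w' → z = z' ∧ w = w'

theorem QuadsEdgeDisjoint.triangle_unique (hG : QuadsEdgeDisjoint G) (huv : G.Adj u v)
    (hup : G.Adj u p) (hvp : G.Adj v p) (huq : G.Adj u q) (hvq : G.Adj v q) : p = q :=
  by_contra fun hpq =>
    hG.not_triangle ⟨hup, hvp.symm, hvq, huq.symm, huv.ne, hpq⟩ huv hvp.symm

theorem QuadsEdgeDisjoint.eq_of_three_common_neighbors (hG : QuadsEdgeDisjoint G) (huv : u ≠ v)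
    (hup : G.Adj u p) (hvp : G.Adj v p) (huq : G.Adj u q) (hvq : G.Adj v q)
    (hur : G.Adj u r) (hvr : G.Adj v r) (hpq : p ≠ q) (hpr : p ≠ r) : q = r :=
  (hG.unique ⟨hup, hvp.symm, hvq, huq.symm, huv, hpq⟩
    ⟨hup, hvp.symm, hvr, hur.symm, huv, hpr⟩).2

/-- `p` is a triangle of `G` with a further neighbour `q i` at each vertex `p i`: the image of the
graph known as the net. -/
structure IsNet (G : SimpleGraph V) (p q : Fin 3 → V) : Prop where
  adj : ∀ {i j}, i ≠ j → G.Adj (p i) (p j)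
  adj_pendant : ∀ i, G.Adj (p i) (q i)
  ne_pendant : ∀ i j, p i ≠ q j

section IsNet

variable {p q : Fin 3 → V} {i j : Fin 3}

theorem exists_ne_ne (i j : Fin 3) : ∃ k, i ≠ k ∧ j ≠ k := by
  revert i j
  decide

theorem IsNet.not_adj_pendant (h : IsNet G p q) (hG : QuadsEdgeDisjoint G) (hij : i ≠ j) :
    ¬ G.Adj (p i) (q j) := by
  intro hadj
  obtain ⟨k, hik, hjk⟩ := exists_ne_ne i j
  exact h.ne_pendant k j
    (hG.triangle_unique (h.adj hij) (h.adj hik) (h.adj hjk) hadj (h.adj_pendant j))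

theorem IsNet.not_adj_pendants (h : IsNet G p q) (hG : QuadsEdgeDisjoint G) (i j : Fin 3) :
    ¬ G.Adj (q i) (q j) := by
  intro hadj
  obtain ⟨k, hik, hjk⟩ := exists_ne_ne i j
  have hij : i ≠ j := by
    rintro rfl
    exact hadj.ne rfl
  exact hG.not_triangle ⟨h.adj hij, h.adj_pendant j, hadj.symm, (h.adj_pendant i).symm,
    h.ne_pendant i j, h.ne_pendant j i⟩ (h.adj hik) (h.adj hjk)

theorem IsNet.pendant_ne (h : IsNet G p q) (hG : QuadsEdgeDisjoint G) (hij : i ≠ j) :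
    q i ≠ q j := by
  intro heq
  exact h.not_adj_pendant hG hij (heq ▸ h.adj_pendant i)

end IsNet

end QuadsEdgeDisjoint

variable {G : Multigraph V} {M a b : V → ℤ} {A B S T : Finset V} {u v x x' y y' z z' : V}

section Degree

theorem mult_eq_zero (h : ¬ G.Adj u v) : G.mult u v = 0 :=
  le_antisymm (not_lt.mp (mt G.mult_pos_iff.mp h)) (G.mult_nonneg u v)

@[simp]
theorem mult_self (v : V) : G.mult v v = 0 := mult_eq_zero (G.irrefl)

/-- The number of edges between `v` and `S`. -/
def degIn (G : Multigraph V) (S : Finset V) (v : V) : ℤ := ∑ u ∈ S, G.mult v u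

theorem degIn_mono (h : S ⊆ T) (v : V) : G.degIn S v ≤ G.degIn T v :=
  Finset.sum_le_sum_of_subset_of_nonneg h fun _ _ _ => G.mult_nonneg _ _

theorem exists_adj_of_degIn_pos (h : 0 < G.degIn S v) : ∃ u ∈ S, G.Adj v u := by
  contrapose! h
  exact Finset.sum_nonpos fun u hu => (mult_eq_zero (h u hu)).le

theorem degIn_eq_of_forall_not_adj (hST : S ⊆ T) (h : ∀ u ∈ T, u ∉ S → ¬ G.Adj v u) :
    G.degIn T v = G.degIn S v :=
  (Finset.sum_subset hST fun u hT hS => mult_eq_zero (h u hT hS)).symm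

variable [DecidableEq V]

theorem degIn_insert (h : u ∉ S) (v : V) : G.degIn (insert u S) v = G.degIn S v + G.mult v u := by
  rw [degIn, Finset.sum_insert h, add_comm, degIn]

theorem degIn_erase (h : u ∈ S) (v : V) : G.degIn (S.erase u) v = G.degIn S v - G.mult v u := by
  rw [degIn, degIn, Finset.sum_erase_eq_sub h]

theorem degIn_insert_of_not_adj (h : ¬ G.Adj v u) : G.degIn (insert u S) v = G.degIn S v :=
  degIn_eq_of_forall_not_adj (Finset.subset_insert u S) (by grind)

theorem degIn_erase_of_not_adj (h : ¬ G.Adj v u) : G.degIn (S.erase u) v = G.degIn S v :=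
  (degIn_eq_of_forall_not_adj (Finset.erase_subset u S) (by grind)).symm

@[simp]
theorem degIn_insert_self (S : Finset V) (v : V) : G.degIn (insert v S) v = G.degIn S v :=
  degIn_insert_of_not_adj G.irrefl

@[simp]
theorem degIn_erase_self (S : Finset V) (v : V) : G.degIn (S.erase v) v = G.degIn S v :=
  degIn_erase_of_not_adj G.irrefl

/-- Twice the number of edges inside `S`, minus twice the sum of `a` over `S`. -/
def energy (G : Multigraph V) (a : V → ℤ) (S : Finset V) : ℤ := ∑ v ∈ S, (G.degIn S v - 2 * a v)

theorem energy_insert (h : u ∉ S) :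
    G.energy a (insert u S) = G.energy a S + 2 * (G.degIn S u - a u) := by
  have hsum : ∑ v ∈ S, G.mult v u = G.degIn S u := Finset.sum_congr rfl fun v _ => G.mult_comm v u
  simp only [energy, Finset.sum_insert h, degIn_insert h, mult_self,
    Finset.sum_sub_distrib, Finset.sum_add_distrib, hsum]
  ring

theorem energy_erase (h : u ∈ S) :
    G.energy a (S.erase u) = G.energy a S - 2 * (G.degIn S u - a u) := by
  have hinsert := energy_insert (G := G) (a := a) (Finset.notMem_erase u S)
  rw [Finset.insert_erase h, degIn_erase_self] at hinsert
  linarith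

end Degree

section Degenerate

/-- Every vertex of `S` has degree at least `a` in `S`. -/
def Feasible (G : Multigraph V) (a : V → ℤ) (S : Finset V) : Prop :=
  ∀ v ∈ S, a v ≤ G.degIn S v

/-- No nonempty subset of `A` is feasible. -/
def Degenerate (G : Multigraph V) (a : V → ℤ) (A : Finset V) : Prop :=
  ∀ S ⊆ A, S.Nonempty → ¬ G.Feasible a S

/-- The vertices of `A` that keep `A` from being feasible. -/
def low (G : Multigraph V) (a : V → ℤ) (A : Finset V) : Finset V := {v ∈ A | G.degIn A v < a v}

theorem mem_low : v ∈ G.low a A ↔ v ∈ A ∧ G.degIn A v < a v := Finset.mem_filter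

theorem mem_of_mem_low (h : v ∈ G.low a A) : v ∈ A := (mem_low.mp h).1

theorem degIn_lt_of_mem_low (h : v ∈ G.low a A) : G.degIn A v < a v := (mem_low.mp h).2

theorem mem_low_of_forall_not_adj (h : v ∈ G.low a S) (hST : S ⊆ T)
    (hv : ∀ u ∈ T, u ∉ S → ¬ G.Adj v u) : v ∈ G.low a T :=
  mem_low.mpr ⟨hST (mem_of_mem_low h),
    (degIn_eq_of_forall_not_adj hST hv).trans_lt (degIn_lt_of_mem_low h)⟩

theorem Degenerate.mono (h : G.Degenerate a A) (hSA : S ⊆ A) : G.Degenerate a S :=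
  fun T hT => h T (hT.trans hSA)

theorem Degenerate.low_nonempty (h : G.Degenerate a A) (hA : A.Nonempty) :
    (G.low a A).Nonempty := by
  obtain ⟨v, hv⟩ : ∃ v ∈ A, G.degIn A v < a v := by simpa [Feasible] using h A subset_rfl hA
  exact ⟨v, mem_low.mpr hv⟩

variable [DecidableEq V]

theorem Degenerate.insert (h : G.Degenerate a A) (hu : G.degIn A u < a u) :
    G.Degenerate a (insert u A) := by
  intro S hS hne hfeas
  by_cases hmem : u ∈ S
  · have hle : G.degIn (S.erase u) u ≤ G.degIn A u := degIn_mono (by grind) u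
    rw [degIn_erase_self] at hle
    linarith [hfeas u hmem]
  · exact h S (by grind) hne hfeas

theorem mem_low_erase (h : v ∈ G.low a A) (hvu : v ≠ u) : v ∈ G.low a (A.erase u) :=
  mem_low.mpr ⟨Finset.mem_erase.mpr ⟨hvu, mem_of_mem_low h⟩,
    (degIn_mono (Finset.erase_subset u A) v).trans_lt (degIn_lt_of_mem_low h)⟩

theorem mem_low_insert (h : v ∈ G.low a A) (hvu : ¬ G.Adj v u) : v ∈ G.low a (insert u A) :=
  mem_low_of_forall_not_adj h (Finset.subset_insert u A) (by grind)

theorem mem_low_insert_self (h : G.degIn A u < a u) : u ∈ G.low a (insert u A) :=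
  mem_low.mpr ⟨Finset.mem_insert_self u A, by rwa [degIn_insert_self]⟩

theorem mem_low_of_mem_low_erase (h : v ∈ G.low a (A.erase u)) (hvu : ¬ G.Adj v u) :
    v ∈ G.low a A :=
  mem_low_of_forall_not_adj h (Finset.erase_subset u A) (by grind)

theorem Degenerate.exists_adj_mem_low_erase (h : G.Degenerate a A) (hlow : G.low a A = {z})
    (hne : (A.erase z).Nonempty) : ∃ v ∈ G.low a (A.erase z), G.Adj v z := by
  obtain ⟨v, hv⟩ := (h.mono (Finset.erase_subset z A)).low_nonempty hne
  refine ⟨v, hv, by_contra fun hvz => ?_⟩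
  have hvA := mem_low_of_mem_low_erase hv hvz
  exact Finset.ne_of_mem_erase (mem_of_mem_low hv) (by simpa [hlow] using hvA)

theorem card_low_insert (hu : u ∉ A) (hd : G.degIn A u < a u)
    (hadj : ∀ z ∈ G.low a A, ¬ G.Adj z u) :
    (G.low a A).card + 1 ≤ (G.low a (insert u A)).card := by
  rw [← Finset.card_insert_of_notMem fun h => hu (mem_of_mem_low h)]
  exact Finset.card_le_card <| Finset.insert_subset (mem_low_insert_self hd)
    fun z hz => mem_low_insert hz (hadj z hz)

theorem card_low_le_card_low_erase (hv : v ∈ G.low a (A.erase u)) (hvA : v ∉ G.low a A) :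
    (G.low a A).card ≤ (G.low a (A.erase u)).card := by
  have hsub : insert v ((G.low a A).erase u) ⊆ G.low a (A.erase u) :=
    Finset.insert_subset hv fun w hw =>
      mem_low_erase (Finset.mem_of_mem_erase hw) (Finset.ne_of_mem_erase hw)
  have hcard := Finset.card_le_card hsub
  rw [Finset.card_insert_of_notMem fun h => hvA (Finset.mem_of_mem_erase h)] at hcard
  exact (Nat.sub_le_iff_le_add.mp Finset.pred_card_le_card_erase).trans hcard

end Degenerate

section Triple

/-- A partition of the vertices into two degenerate sets and a single vertex, the centre. -/
structure Triple (G : Multigraph V) (a b : V → ℤ) (A : Finset V) (x : V) (B : Finset V) :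
    Prop where
  notMem_left : x ∉ A
  notMem_right : x ∉ B
  disjoint : Disjoint A B
  eq_or_mem_or_mem : ∀ v, v = x ∨ v ∈ A ∨ v ∈ B
  left : G.Degenerate a A
  right : G.Degenerate b B

/-- The quantity maximised over all triples. The penalties make a maximum triple have a centre of
degree at least `a x - 1` in `A` and at least `b x - 1` in `B`. -/
def potential (G : Multigraph V) (a b : V → ℤ) (A : Finset V) (x : V) (B : Finset V) : ℤ :=
  G.energy a A + G.energy b B
    - 2 * max 0 (a x - 1 - G.degIn A x) - 2 * max 0 (b x - 1 - G.degIn B x)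

theorem potential_eq_of_le (hA : a x - 1 ≤ G.degIn A x) (hB : b x - 1 ≤ G.degIn B x) :
    G.potential a b A x B = G.energy a A + G.energy b B := by
  unfold potential
  omega

theorem potential_symm (A B : Finset V) (x : V) :
    G.potential b a B x A = G.potential a b A x B := by
  unfold potential
  ring

theorem Triple.symm (h : G.Triple a b A x B) : G.Triple b a B x A where
  notMem_left := h.notMem_right
  notMem_right := h.notMem_left
  disjoint := h.disjoint.symm
  eq_or_mem_or_mem v := (h.eq_or_mem_or_mem v).imp_right Or.symm
  left := h.right
  right := h.left

theorem Triple.notMem_left_of_mem (h : G.Triple a b A x B) (hv : v ∈ B) : v ∉ A :=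
  Finset.disjoint_right.mp h.disjoint hv

/-- A triple of maximum potential. -/
structure MaxTriple (G : Multigraph V) (a b : V → ℤ) (A : Finset V) (x : V) (B : Finset V) :
    Prop extends G.Triple a b A x B where
  potential_le : ∀ {A' x' B'}, G.Triple a b A' x' B' →
    G.potential a b A' x' B' ≤ G.potential a b A x B

theorem MaxTriple.symm (h : G.MaxTriple a b A x B) : G.MaxTriple b a B x A where
  toTriple := h.toTriple.symm
  potential_le h' := by
    rw [potential_symm, potential_symm A]
    exact h.potential_le h'.symm

theorem MaxTriple.of_le {A' B' : Finset V} {x' : V} (h : G.MaxTriple a b A x B)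
    (h' : G.Triple a b A' x' B') (hle : G.potential a b A x B ≤ G.potential a b A' x' B') :
    G.MaxTriple a b A' x' B' where
  toTriple := h'
  potential_le h'' := (h.potential_le h'').trans hle

variable [DecidableEq V]

theorem Triple.notMem_erase (h : G.Triple a b A x B) (y : V) : x ∉ B.erase y :=
  fun hx => h.notMem_right (Finset.mem_of_mem_erase hx)

theorem Triple.transfer (h : G.Triple a b A x B) (hy : y ∈ B) (hA : G.Degenerate a (insert y A)) :
    G.Triple a b (insert y A) x (B.erase y) where
  notMem_left := by grind [h.notMem_left, h.notMem_right]
  notMem_right := h.notMem_erase y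
  disjoint := by grind [Finset.disjoint_left, h.disjoint]
  eq_or_mem_or_mem v := by grind [h.eq_or_mem_or_mem v]
  left := hA
  right := h.right.mono (Finset.erase_subset y B)

theorem Triple.recenter (h : G.Triple a b A x B) (hy : y ∈ B)
    (hB : G.Degenerate b (insert x (B.erase y))) : G.Triple a b A y (insert x (B.erase y)) where
  notMem_left := h.notMem_left_of_mem hy
  notMem_right := by grind [h.notMem_right]
  disjoint := by grind [Finset.disjoint_left, h.disjoint, h.notMem_left]
  eq_or_mem_or_mem v := by grind [h.eq_or_mem_or_mem v]
  left := h.left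
  right := hB

theorem Triple.recenter_cross (h : G.Triple a b A x B) (hy : y ∈ B)
    (hA : G.Degenerate a (insert x A)) : G.Triple a b (insert x A) y (B.erase y) where
  notMem_left := by grind [h.notMem_left_of_mem hy, h.notMem_right]
  notMem_right := Finset.notMem_erase y B
  disjoint := by grind [Finset.disjoint_left, h.disjoint, h.notMem_right]
  eq_or_mem_or_mem v := by grind [h.eq_or_mem_or_mem v]
  left := hA
  right := h.right.mono (Finset.erase_subset y B)

end Triple

section Counterexample

variable [Fintype V]

/-- The degree condition of the theorem. The bound `M v` on the multiplicities at `v` need not be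
attained. -/
structure LargeDegrees (G : Multigraph V) (M a b : V → ℤ) : Prop where
  mult_le : ∀ u v, G.mult u v ≤ M u
  two_le_left : ∀ v, 2 ≤ a v
  two_le_right : ∀ v, 2 ≤ b v
  le_degIn_univ : ∀ v, a v + b v + 2 * M v - 3 ≤ G.degIn Finset.univ v

theorem LargeDegrees.symm (hG : G.LargeDegrees M a b) : G.LargeDegrees M b a where
  mult_le := hG.mult_le
  two_le_left := hG.two_le_right
  two_le_right := hG.two_le_left
  le_degIn_univ v := by linarith [hG.le_degIn_univ v]

theorem LargeDegrees.one_le_bound (hG : G.LargeDegrees M a b) (v : V) : 1 ≤ M v := by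
  have hdeg : 0 < G.degIn Finset.univ v := by
    have hM : 0 ≤ M v := (G.mult_nonneg v v).trans (hG.mult_le v v)
    linarith [hG.le_degIn_univ v, hG.two_le_left v, hG.two_le_right v]
  obtain ⟨u, -, hu⟩ := exists_adj_of_degIn_pos hdeg
  exact (G.mult_pos_iff.mpr hu).trans_le (hG.mult_le v u)

/-- A counterexample to the theorem, in the weaker form asking for two disjoint nonempty feasible
sets that need not cover all vertices. -/
structure Counterexample (G : Multigraph V) (M a b : V → ℤ) : Prop
    extends G.LargeDegrees M a b where
  quads : QuadsEdgeDisjoint G.toSimpleGraph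
  not_feasible : ∀ {S T : Finset V}, S.Nonempty → T.Nonempty → Disjoint S T →
    G.Feasible a S → ¬ G.Feasible b T

theorem Counterexample.symm (hG : G.Counterexample M a b) : G.Counterexample M b a where
  toLargeDegrees := hG.toLargeDegrees.symm
  quads := hG.quads
  not_feasible hS hT hST hSb hTa := hG.not_feasible hT hS hST.symm hTa hSb

theorem Counterexample.exists_adj_left (hG : G.Counterexample M a b)
    (hx : G.degIn A x = a x - 1) : ∃ u ∈ A, G.Adj x u :=
  exists_adj_of_degIn_pos (by linarith [hG.two_le_left x])

theorem Counterexample.degenerate_or_degenerate (hG : G.Counterexample M a b)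
    (hST : Disjoint S T) : G.Degenerate a S ∨ G.Degenerate b T := by
  by_contra! h
  simp only [Degenerate, not_forall, not_not] at h
  obtain ⟨⟨S', hS, hS', hSa⟩, T', hT, hT', hTb⟩ := h
  exact hG.not_feasible hS' hT' (hST.mono hS hT) hSa hTb

theorem Triple.degIn_add_degIn (h : G.Triple a b A x B) (v : V) :
    G.degIn A v + G.degIn B v + G.mult v x = G.degIn Finset.univ v := by
  classical
  have huniv : (Finset.univ : Finset V) = insert x (A ∪ B) := by
    ext u
    simpa using h.eq_or_mem_or_mem u
  have hx : x ∉ A ∪ B := by simp [h.notMem_left, h.notMem_right]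
  rw [huniv, degIn_insert hx, degIn, degIn, degIn, Finset.sum_union h.disjoint]

theorem Triple.le_degIn_add_degIn (h : G.Triple a b A x B) (hG : G.Counterexample M a b) (v : V) :
    a v + b v + 2 * M v - 3 ≤ G.degIn A v + G.degIn B v + G.mult v x :=
  (hG.le_degIn_univ v).trans_eq (h.degIn_add_degIn v).symm

theorem Triple.le_degIn_center (h : G.Triple a b A x B) (hG : G.Counterexample M a b) :
    a x + b x + 2 * M x - 3 ≤ G.degIn A x + G.degIn B x := by
  simpa using h.le_degIn_add_degIn hG x

theorem Triple.left_nonempty (h : G.Triple a b A x B) (hG : G.Counterexample M a b) :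
    A.Nonempty := by
  rw [Finset.nonempty_iff_ne_empty]
  rintro rfl
  have hdeg (v : V) : a v + b v + 2 * M v - 3 ≤ G.degIn B v + G.mult v x := by
    simpa [degIn] using h.le_degIn_add_degIn hG v
  have hB : B.Nonempty := by
    rw [Finset.nonempty_iff_ne_empty]
    rintro rfl
    have hx : a x + b x + 2 * M x - 3 ≤ 0 := by simpa [degIn] using hdeg x
    linarith [hG.two_le_left x, hG.two_le_right x, hG.one_le_bound x]
  obtain ⟨y, hy⟩ := h.right.low_nonempty hB
  linarith [hdeg y, degIn_lt_of_mem_low hy, hG.two_le_left y, hG.one_le_bound y, hG.mult_le y x]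

theorem Triple.low_left_nonempty (h : G.Triple a b A x B) (hG : G.Counterexample M a b) :
    (G.low a A).Nonempty := h.left.low_nonempty (h.left_nonempty hG)

theorem Triple.low_right_nonempty (h : G.Triple a b A x B) (hG : G.Counterexample M a b) :
    (G.low b B).Nonempty := h.symm.low_left_nonempty hG.symm

variable [DecidableEq V]

theorem Triple.degenerate_insert_or (h : G.Triple a b A x B) (hG : G.Counterexample M a b)
    (hy : y ∈ B) : G.Degenerate a (insert y A) ∨ G.Degenerate b (insert x (B.erase y)) :=
  hG.degenerate_or_degenerate (by
    grind [Finset.disjoint_left, h.disjoint, h.notMem_left, h.notMem_right])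

end Counterexample

section MaxTriple

variable [Fintype V]

theorem MaxTriple.not_degenerate_insert [DecidableEq V] (h : G.MaxTriple a b A x B)
    (hG : G.Counterexample M a b) (hx : b x ≤ G.degIn B x) : ¬ G.Degenerate b (insert x B) := by
  intro hdeg
  obtain ⟨z, hz⟩ := h.low_left_nonempty hG
  have hlow := degIn_lt_of_mem_low hz
  have hle := h.potential_le (h.symm.toTriple.recenter_cross (mem_of_mem_low hz) hdeg).symm
  have hz' := h.le_degIn_add_degIn hG z
  have hM := hG.one_le_bound z
  rw [potential, potential, energy_erase (mem_of_mem_low hz), energy_insert h.notMem_right,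
    degIn_insert h.notMem_right, degIn_erase_self] at hle
  omega

theorem MaxTriple.fill (h : G.MaxTriple a b A x B) (hG : G.Counterexample M a b)
    (hx : b x ≤ G.degIn B x) (hu : u ∈ B) : b u ≤ G.degIn B u + G.mult u x := by
  classical
  by_contra! hlt
  have hxu : x ∉ B.erase u := h.notMem_erase u
  have hnot : ¬ G.Degenerate b (insert x (B.erase u)) := by
    intro hdeg
    have hins := hdeg.insert (u := u) (by rwa [degIn_insert hxu, degIn_erase_self])
    rw [Finset.insert_comm, Finset.insert_erase hu] at hins
    exact h.not_degenerate_insert hG hx hins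
  have hx' : b x ≤ G.degIn (B.erase u) x :=
    not_lt.mp fun hlt' => hnot ((h.right.mono (Finset.erase_subset u B)).insert hlt')
  have hle := h.potential_le
    (h.toTriple.transfer hu ((h.degenerate_insert_or hG hu).resolve_right hnot))
  have huA : u ∉ A := h.notMem_left_of_mem hu
  have hu' := h.le_degIn_add_degIn hG u
  have hM := hG.one_le_bound u
  have hnonneg := G.mult_nonneg u x
  have hnonneg' := G.mult_nonneg x u
  rw [potential, potential, energy_erase hu, energy_insert huA, degIn_insert huA] at hle
  omega

theorem MaxTriple.le_left (h : G.MaxTriple a b A x B) (hG : G.Counterexample M a b) :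
    a x - 1 ≤ G.degIn A x := by
  classical
  by_contra! hlt
  have hx := h.le_degIn_center hG
  have hMx := hG.one_le_bound x
  obtain ⟨y, hlow⟩ := h.low_right_nonempty hG
  have hy := mem_of_mem_low hlow
  have hyA := h.notMem_left_of_mem hy
  have hfill := h.fill hG (by linarith) hy
  have hdeg := h.le_degIn_add_degIn hG y
  have hlt' := degIn_lt_of_mem_low hlow
  have hMy := hG.one_le_bound y
  have hle := hG.mult_le x y
  have hle' := hG.mult_le y x
  have hcomm := G.mult_comm x y
  rcases h.degenerate_insert_or hG hy with hA | hB
  · have hpot := h.potential_le (h.toTriple.transfer hy hA)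
    rw [potential, potential, energy_erase hy, energy_insert hyA, degIn_insert hyA,
      degIn_erase hy] at hpot
    omega
  · have hpot := h.potential_le (h.toTriple.recenter hy hB)
    have hxy := h.notMem_erase y
    rw [potential, potential, energy_insert hxy, energy_erase hy, degIn_insert hxy,
      degIn_erase hy, degIn_erase_self] at hpot
    omega

theorem MaxTriple.le_right (h : G.MaxTriple a b A x B) (hG : G.Counterexample M a b) :
    b x - 1 ≤ G.degIn B x := h.symm.le_left hG.symm

theorem MaxTriple.potential_eq (h : G.MaxTriple a b A x B) (hG : G.Counterexample M a b) :
    G.potential a b A x B = G.energy a A + G.energy b B :=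
  potential_eq_of_le (h.le_left hG) (h.le_right hG)

theorem MaxTriple.adj_of_mem_low_right (h : G.MaxTriple a b A x B) (hG : G.Counterexample M a b)
    (hx : b x ≤ G.degIn B x) (hy : y ∈ G.low b B) : G.Adj x y := by
  refine (G.mult_pos_iff.mp ?_).symm
  linarith [h.fill hG hx (mem_of_mem_low hy), degIn_lt_of_mem_low hy]

theorem MaxTriple.adj_of_mem_low_left (h : G.MaxTriple a b A x B) (hG : G.Counterexample M a b)
    (hx : a x ≤ G.degIn A x) (hz : z ∈ G.low a A) : G.Adj x z :=
  h.symm.adj_of_mem_low_right hG.symm hx hz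

theorem MaxTriple.degIn_left_of_not_adj (h : G.MaxTriple a b A x B) (hG : G.Counterexample M a b)
    (hz : z ∈ G.low a A) (hxz : ¬ G.Adj x z) : G.degIn A x = a x - 1 :=
  le_antisymm (Int.le_sub_one_of_lt (not_le.mp fun hx => hxz (h.adj_of_mem_low_left hG hx hz)))
    (h.le_left hG)

variable [DecidableEq V]

theorem MaxTriple.recenter_cross (h : G.MaxTriple a b A x B) (hG : G.Counterexample M a b)
    (hx : G.degIn A x = a x - 1) (hy : y ∈ G.low b B) :
    G.degIn B y = b y - 1 ∧ G.MaxTriple a b (insert x A) y (B.erase y) := by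
  have hlow := degIn_lt_of_mem_low hy
  have htriple := h.toTriple.recenter_cross (mem_of_mem_low hy) (h.left.insert (by linarith))
  have hdeg := htriple.le_degIn_center hG
  have hM := hG.one_le_bound y
  rw [degIn_erase_self] at hdeg
  have hmax : G.MaxTriple a b (insert x A) y (B.erase y) := by
    refine h.of_le htriple ?_
    rw [h.potential_eq hG, potential, energy_insert h.notMem_left,
      energy_erase (mem_of_mem_low hy), degIn_erase_self]
    omega
  have hle := hmax.le_right hG
  rw [degIn_erase_self] at hle
  exact ⟨by linarith, hmax⟩

theorem MaxTriple.transfer_of_eq (h : G.MaxTriple a b A x B) (hG : G.Counterexample M a b)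
    (hy : y ∈ B) (hyB : G.degIn B y = b y - 1) (hyA : G.degIn A y = a y - 1)
    (hx : b x - 1 ≤ G.degIn B x - G.mult x y) : G.MaxTriple a b (insert y A) x (B.erase y) := by
  have hyA' := h.notMem_left_of_mem hy
  refine h.of_le (h.toTriple.transfer hy (h.left.insert (by linarith))) ?_
  rw [h.potential_eq hG, potential_eq_of_le, energy_insert hyA', energy_erase hy]
  · linarith
  · rw [degIn_insert hyA']
    linarith [h.le_left hG, G.mult_nonneg x y]
  · rwa [degIn_erase hy]

end MaxTriple

section PivotLeaf

variable [DecidableEq V]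

/-- The vertex `y` of `B` can replace the centre `x` of the maximum triple `(A, x, B)`. -/
structure IsPivot (G : Multigraph V) (a b : V → ℤ) (A : Finset V) (x : V) (B : Finset V) (y : V) :
    Prop where
  mem : y ∈ B
  degIn_eq : G.degIn B y = b y - 1
  degIn_center : G.degIn B x = b x + G.mult x y - 1
  maxTriple : G.MaxTriple a b A y (insert x (B.erase y))

/-- The vertex `y` of `B`, joined to the centre `x` by a single edge, can be moved to the other
side of the maximum triple `(A, x, B)`. -/
structure IsLeaf (G : Multigraph V) (a b : V → ℤ) (A : Finset V) (x : V) (B : Finset V) (y : V) :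
    Prop where
  mem : y ∈ B
  mult_eq_one : G.mult x y = 1
  degIn_right : G.degIn B y = b y - 1
  degIn_left : G.degIn A y = a y - 1
  maxTriple : G.MaxTriple a b (insert y A) x (B.erase y)

theorem IsLeaf.mem_low_left (hy : G.IsLeaf a b A x B y) : y ∈ G.low a (insert y A) :=
  mem_low_insert_self (by linarith [hy.degIn_left])

variable [Fintype V]

theorem MaxTriple.isPivot_or_isLeaf (h : G.MaxTriple a b A x B) (hG : G.Counterexample M a b)
    (hy : y ∈ G.low b B) (hxy : G.Adj x y) (hx : b x + G.mult x y - 1 ≤ G.degIn B x) :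
    G.IsPivot a b A x B y ∨ G.IsLeaf a b A x B y := by
  have hyB := mem_of_mem_low hy
  have hyA := h.notMem_left_of_mem hyB
  have hxBy := h.notMem_erase y
  have hlow := degIn_lt_of_mem_low hy
  have hpos := G.mult_pos_iff.mpr hxy
  have hfill := h.fill hG (by linarith) hyB
  have hdeg := h.le_degIn_add_degIn hG y
  have hle := hG.mult_le y x
  have hcomm := G.mult_comm x y
  have hpot := h.potential_eq hG
  rcases h.degenerate_insert_or hG hyB with hA | hB
  · have htriple := h.toTriple.transfer hyB hA
    have hpot' : G.potential a b (insert y A) x (B.erase y) = _ :=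
      potential_eq_of_le (by rw [degIn_insert hyA]; linarith [h.le_left hG])
        (by rw [degIn_erase hyB]; linarith)
    rw [energy_insert hyA, energy_erase hyB] at hpot'
    have hmax := h.potential_le htriple
    exact Or.inr ⟨hyB, by omega, by omega, by omega, h.of_le htriple (by omega)⟩
  · have htriple := h.toTriple.recenter hyB hB
    have hpot' : G.potential a b A y (insert x (B.erase y)) = _ :=
      potential_eq_of_le (by linarith) (by rw [degIn_insert hxBy, degIn_erase_self]; linarith)
    rw [energy_insert hxBy, energy_erase hyB, degIn_erase hyB] at hpot'
    have hmax := h.potential_le htriple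
    exact Or.inl ⟨hyB, by omega, by omega, h.of_le htriple (by omega)⟩

theorem MaxTriple.isLeaf_of_not_adj (h : G.MaxTriple a b A x B) (hG : G.Counterexample M a b)
    (hy : y ∈ G.low b B) (hxy : G.Adj x y) (hx : b x + G.mult x y - 1 ≤ G.degIn B x)
    (hz : z ∈ G.low a A) (hyz : ¬ G.Adj y z) : G.IsLeaf a b A x B y := by
  obtain hpivot | hleaf := h.isPivot_or_isLeaf hG hy hxy hx
  · have hyA := hpivot.maxTriple.degIn_left_of_not_adj hG hz hyz
    have hdeg := h.le_degIn_add_degIn hG y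
    have hyB := hpivot.degIn_eq
    have hM := hG.one_le_bound y
    have hle := hG.mult_le y x
    have hmult : G.mult x y = 1 := by
      rw [G.mult_comm]
      omega
    exact ⟨mem_of_mem_low hy, hmult, hyB, hyA,
      h.transfer_of_eq hG (mem_of_mem_low hy) hyB hyA (by linarith)⟩
  · exact hleaf

end PivotLeaf

section MaxPair

variable [DecidableEq V]

/-- `(A, B)` is a partition of the vertices that becomes a maximum triple when a vertex `x` of
degree `a x - 1` is taken out of `A`. -/
def MaxPair (G : Multigraph V) (a b : V → ℤ) (A B : Finset V) : Prop :=
  ∃ x ∈ A, G.degIn A x = a x - 1 ∧ G.MaxTriple a b (A.erase x) x B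

theorem MaxPair.disjoint (h : G.MaxPair a b A B) : Disjoint A B := by
  obtain ⟨x, hxA, -, hmax⟩ := h
  rw [← Finset.insert_erase hxA]
  exact Finset.disjoint_insert_left.mpr ⟨hmax.notMem_right, hmax.disjoint⟩

theorem MaxPair.degenerate_left (h : G.MaxPair a b A B) : G.Degenerate a A := by
  obtain ⟨x, hxA, hx, hmax⟩ := h
  have hins := hmax.left.insert (u := x) (by rw [degIn_erase_self]; linarith)
  rwa [Finset.insert_erase hxA] at hins

theorem MaxTriple.maxPair (h : G.MaxTriple a b A x B) (hx : G.degIn A x = a x - 1) :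
    G.MaxPair a b (insert x A) B :=
  ⟨x, Finset.mem_insert_self x A, by rwa [degIn_insert_self],
    by rwa [Finset.erase_insert h.notMem_left]⟩

variable [Fintype V]

theorem MaxPair.maxTriple_right (h : G.MaxPair a b A B) (hG : G.Counterexample M a b)
    (hy : y ∈ G.low b B) : G.degIn B y = b y - 1 ∧ G.MaxTriple a b A y (B.erase y) := by
  obtain ⟨x, hxA, hx, hmax⟩ := h
  have hcross := hmax.recenter_cross hG (by rwa [degIn_erase_self]) hy
  rwa [Finset.insert_erase hxA] at hcross

theorem MaxPair.symm (h : G.MaxPair a b A B) (hG : G.Counterexample M a b) :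
    G.MaxPair b a B A := by
  obtain ⟨x, -, -, hmax⟩ := id h
  obtain ⟨y, hy⟩ := hmax.low_right_nonempty hG
  obtain ⟨hyB, hmax'⟩ := h.maxTriple_right hG hy
  exact ⟨y, mem_of_mem_low hy, hyB, hmax'.symm⟩

theorem MaxPair.maxTriple_left (h : G.MaxPair a b A B) (hG : G.Counterexample M a b)
    (hx : x ∈ G.low a A) : G.degIn A x = a x - 1 ∧ G.MaxTriple a b (A.erase x) x B :=
  ((h.symm hG).maxTriple_right hG.symm hx).imp_right MaxTriple.symm

theorem MaxTriple.maxPair_right (h : G.MaxTriple a b A x B) (hG : G.Counterexample M a b)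
    (hx : G.degIn B x = b x - 1) : G.MaxPair a b A (insert x B) :=
  (h.symm.maxPair hx).symm hG.symm

theorem MaxPair.le_degIn (h : G.MaxPair a b A B) (hG : G.Counterexample M a b)
    (hx : x ∈ G.low a A) : b x + 2 * M x - 2 ≤ G.degIn B x := by
  obtain ⟨hxA, hmax⟩ := h.maxTriple_left hG hx
  have hdeg := hmax.le_degIn_center hG
  rw [degIn_erase_self] at hdeg
  linarith

theorem MaxPair.adj (h : G.MaxPair a b A B) (hG : G.Counterexample M a b)
    (hx : x ∈ G.low a A) (hy : y ∈ G.low b B) : G.Adj x y :=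
  (h.maxTriple_left hG hx).2.adj_of_mem_low_right hG
    (by linarith [h.le_degIn hG hx, hG.one_le_bound x]) hy

theorem MaxPair.isQuad (h : G.MaxPair a b A B) (hG : G.Counterexample M a b)
    (hx : x ∈ G.low a A) (hx' : x' ∈ G.low a A) (hxx' : x ≠ x')
    (hy : y ∈ G.low b B) (hy' : y' ∈ G.low b B) (hyy' : y ≠ y') :
    IsQuad G.toSimpleGraph x y x' y' :=
  ⟨h.adj hG hx hy, (h.adj hG hx' hy).symm, h.adj hG hx' hy', (h.adj hG hx hy').symm, hxx', hyy'⟩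

theorem MaxPair.exchange (h : G.MaxPair a b A B) (hG : G.Counterexample M a b)
    (hx : x ∈ G.low a A) (hy : y ∈ G.low b B) (hu : u ∈ G.low a (A.erase x)) (hyu : ¬ G.Adj y u)
    (hv : v ∈ G.low b (B.erase y)) (hxv : ¬ G.Adj x v) :
    G.MaxPair a b (insert y (A.erase x)) (insert x (B.erase y)) := by
  have hdeg : b x + G.mult x y - 1 ≤ G.degIn B x := by
    linarith [h.le_degIn hG hx, hG.one_le_bound x, hG.mult_le x y]
  obtain hpivot | hleaf :=
    (h.maxTriple_left hG hx).2.isPivot_or_isLeaf hG hy (h.adj hG hx hy) hdeg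
  · exact hpivot.maxTriple.maxPair (hpivot.maxTriple.degIn_left_of_not_adj hG hu hyu)
  · exact hleaf.maxTriple.maxPair_right hG
      (hleaf.maxTriple.symm.degIn_left_of_not_adj hG.symm hv hxv)

theorem MaxPair.exists_adj_mem_low_erase (h : G.MaxPair a b A B) (hG : G.Counterexample M a b)
    (hx : x ∈ G.low a A) (hx' : x' ∈ G.low a A) (hxx' : x ≠ x')
    (hy : y ∈ G.low b B) (hy' : y' ∈ G.low b B) (hyy' : y ≠ y') :
    ∃ z ∈ G.low a A, ∃ z' ∈ G.low a A, z ≠ z' ∧ ∃ u ∈ G.low a (A.erase z), G.Adj u z := by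
  have hquad := h.isQuad hG hx hx' hxx' hy hy' hyy'
  have hnadj : ¬ G.Adj x x' := fun hadj =>
    hyy' (hG.quads.triangle_unique hadj hquad.adj_xy hquad.adj_yz.symm hquad.adj_wx.symm
      hquad.adj_zw)
  have hnonempty : ((A.erase x).erase x').Nonempty := by
    obtain ⟨u, hu, hxu⟩ := hG.exists_adj_left (h.maxTriple_left hG hx).1
    exact ⟨u, Finset.mem_erase.mpr ⟨by rintro rfl; exact hnadj hxu,
      Finset.mem_erase.mpr ⟨hxu.ne', hu⟩⟩⟩
  obtain ⟨u, hu⟩ := (h.degenerate_left.mono (by grind)).low_nonempty hnonempty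
  have huA : u ∈ A := by grind [mem_of_mem_low hu]
  by_cases hux' : G.Adj u x'
  · have hux : ¬ G.Adj u x := fun hux =>
      hyy' (hG.quads.eq_of_three_common_neighbors hxx' hux.symm hux'.symm hquad.adj_xy
        hquad.adj_yz.symm hquad.adj_wx.symm hquad.adj_zw
        (Finset.disjoint_iff_ne.mp h.disjoint u huA y (mem_of_mem_low hy))
        (Finset.disjoint_iff_ne.mp h.disjoint u huA y' (mem_of_mem_low hy')))
    rw [Finset.erase_right_comm] at hu
    exact ⟨x', hx', x, hx, hxx'.symm, u, mem_low_of_mem_low_erase hu hux, hux'⟩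
  refine ⟨x, hx, x', hx', hxx', u, mem_low_of_mem_low_erase hu hux', by_contra fun hux => ?_⟩
  have hlow := mem_low_of_mem_low_erase (mem_low_of_mem_low_erase hu hux') hux
  have hux : u ≠ x := by grind [mem_of_mem_low hu]
  have hux' : u ≠ x' := by grind [mem_of_mem_low hu]
  exact hux' (hG.quads.eq_of_three_common_neighbors hyy' hquad.adj_xy.symm hquad.adj_wx
    (h.adj hG hlow hy).symm (h.adj hG hlow hy').symm hquad.adj_yz hquad.adj_zw.symm hux.symm hxx')

theorem MaxPair.eq_of_two_low (h : G.MaxPair a b A B) (hG : G.Counterexample M a b)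
    (hx : x ∈ G.low a A) (hx' : x' ∈ G.low a A) (hxx' : x ≠ x')
    (hy : y ∈ G.low b B) (hy' : y' ∈ G.low b B) : y = y' := by
  by_contra! hyy'
  obtain ⟨z, hz, z', hz', hzz', u, hu, huz⟩ :=
    h.exists_adj_mem_low_erase hG hx hx' hxx' hy hy' hyy'
  obtain ⟨w, hw, w', hw', hww', v, hv, hvw⟩ :=
    (h.symm hG).exists_adj_mem_low_erase hG.symm hy hy' hyy' hx hx' hxx'
  have hquad := h.isQuad hG hz hz' hzz' hw hw' hww'
  have hwu : ¬ G.Adj w u := hG.quads.not_triangle hquad huz.symm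
  have hzv : ¬ G.Adj z v := fun hzv => hG.quads.not_triangle hquad hzv hvw.symm
  have huv : G.Adj u v := (h.exchange hG hz hw hu hwu hv hzv).adj hG
    (mem_low_insert hu fun huw => hwu huw.symm) (mem_low_insert hv fun hvz => hzv hvz.symm)
  have hne := Finset.disjoint_iff_ne.mp h.disjoint
  have hvB := Finset.mem_of_mem_erase (mem_of_mem_low hv)
  have huA := Finset.mem_of_mem_erase (mem_of_mem_low hu)
  have hquad' : IsQuad G.toSimpleGraph z w v u :=
    ⟨hquad.adj_xy, hvw.symm, huv.symm, huz, hne z (mem_of_mem_low hz) v hvB,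
      (hne u huA w (mem_of_mem_low hw)).symm⟩
  exact hne z' (mem_of_mem_low hz') v hvB (hG.quads.unique hquad hquad').1

end MaxPair

section Star

/-- A maximum triple whose centre is adjacent to all low vertices, of which there are at least
three. -/
structure Star (G : Multigraph V) (a b : V → ℤ) (A : Finset V) (x : V) (B : Finset V) :
    Prop extends G.MaxTriple a b A x B where
  adj_left : ∀ {z}, z ∈ G.low a A → G.Adj x z
  adj_right : ∀ {y}, y ∈ G.low b B → G.Adj x y
  three_le_card : 3 ≤ (G.low a A).card + (G.low b B).card

theorem Star.symm (h : G.Star a b A x B) : G.Star b a B x A where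
  toMaxTriple := h.toMaxTriple.symm
  adj_left := h.adj_right
  adj_right := h.adj_left
  three_le_card := by
    rw [add_comm]
    exact h.three_le_card

variable [Fintype V]

theorem MaxTriple.adj_of_two_low (h : G.MaxTriple a b A x B) (hG : G.Counterexample M a b)
    (hz : z ∈ G.low a A) (hy : y ∈ G.low b B) (hy' : y' ∈ G.low b B) (hyy' : y ≠ y') :
    G.Adj x z := by
  classical
  by_contra hxz
  have hx := h.degIn_left_of_not_adj hG hz hxz
  exact hyy' ((h.maxPair hx).eq_of_two_low hG (mem_low_insert_self (by linarith))
    (mem_low_insert hz fun hzx => hxz hzx.symm)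
    (fun hxz => h.notMem_left (hxz ▸ mem_of_mem_low hz)) hy hy')

theorem MaxTriple.star_of_two_low_left (h : G.MaxTriple a b A x B) (hG : G.Counterexample M a b)
    (hx : a x ≤ G.degIn A x) (hz : z ∈ G.low a A) (hz' : z' ∈ G.low a A) (hzz' : z ≠ z') :
    G.Star a b A x B where
  toMaxTriple := h
  adj_left := h.adj_of_mem_low_left hG hx
  adj_right hy := h.symm.adj_of_two_low hG.symm hy hz hz' hzz'
  three_le_card :=
    Nat.add_le_add (Finset.one_lt_card.mpr ⟨z, hz, z', hz', hzz'⟩)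
      (Finset.card_pos.mpr (h.low_right_nonempty hG))

theorem MaxTriple.recenter_of_not_adj [DecidableEq V] (h : G.MaxTriple a b A x B)
    (hG : G.Counterexample M a b) (hx : b x + G.mult x y - 1 ≤ G.degIn B x) (hy : y ∈ G.low b B)
    (hxy : G.Adj x y) (hv : v ∈ G.low b (B.erase y)) (hxv : ¬ G.Adj x v) :
    G.degIn (B.erase y) x = b x - 1 ∧ G.degIn B y = b y - 1 ∧
      G.MaxTriple a b A y (insert x (B.erase y)) := by
  obtain hpivot | hleaf := h.isPivot_or_isLeaf hG hy hxy hx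
  · refine ⟨?_, hpivot.degIn_eq, hpivot.maxTriple⟩
    rw [degIn_erase hpivot.mem]
    linarith [hpivot.degIn_center]
  · have hxB := hleaf.maxTriple.symm.degIn_left_of_not_adj hG.symm hv hxv
    have hmax := ((hleaf.maxTriple.maxPair_right hG hxB).maxTriple_left hG hleaf.mem_low_left).2
    rw [Finset.erase_insert (h.notMem_left_of_mem hleaf.mem)] at hmax
    exact ⟨hxB, hleaf.degIn_right, hmax⟩

theorem MaxTriple.star_of_not_adj [DecidableEq V] (h : G.MaxTriple a b A x B)
    (hG : G.Counterexample M a b) (hx : b x + G.mult x y - 1 ≤ G.degIn B x) (hy : y ∈ G.low b B)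
    (hxy : G.Adj x y) (hv : v ∈ G.low b (B.erase y)) (hxv : ¬ G.Adj x v) :
    G.Star a b A y (insert x (B.erase y)) := by
  obtain ⟨hxB, hyB, hmax⟩ := h.recenter_of_not_adj hG hx hy hxy hv hxv
  have hxBy := h.notMem_erase y
  have hle : b y ≤ G.degIn (insert x (B.erase y)) y := by
    rw [degIn_insert hxBy, degIn_erase_self]
    linarith [G.mult_pos_iff.mpr hxy.symm]
  exact (hmax.symm.star_of_two_low_left hG.symm hle (mem_low_insert_self (by linarith))
    (mem_low_insert hv fun hvx => hxv hvx.symm)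
    (ne_of_mem_of_not_mem (mem_of_mem_low hv) hxBy).symm).symm

theorem IsLeaf.star [DecidableEq V] (hy : G.IsLeaf a b A x B y) (hG : G.Counterexample M a b)
    (h : G.MaxTriple a b A x B) (hz : z ∈ G.low a A) (hyz : ¬ G.Adj y z) :
    G.Star a b (insert y A) x (B.erase y) := by
  have hyA := h.notMem_left_of_mem hy.mem
  have hle : a x ≤ G.degIn (insert y A) x := by
    rw [degIn_insert hyA, hy.mult_eq_one]
    linarith [h.le_left hG]
  exact hy.maxTriple.star_of_two_low_left hG hle hy.mem_low_left
    (mem_low_insert hz fun hzy => hyz hzy.symm) (fun hyz => hyA (hyz ▸ mem_of_mem_low hz))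

theorem IsLeaf.adj_of_mem_low_erase [DecidableEq V] (hy : G.IsLeaf a b A x B y)
    (hG : G.Counterexample M a b) (h : G.MaxTriple a b A x B) (hz : z ∈ G.low a A)
    (hyz : ¬ G.Adj y z) (hv : v ∈ G.low b (B.erase y)) : G.Adj x v :=
  (hy.star hG h hz hyz).adj_right hv

theorem MaxTriple.exists_star_of_not_adj (h : G.MaxTriple a b A x B)
    (hG : G.Counterexample M a b) (hz : z ∈ G.low a A) (hxz : ¬ G.Adj x z) :
    ∃ A' x' B', G.Star a b A' x' B' := by
  classical
  have hx := h.degIn_left_of_not_adj hG hz hxz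
  obtain ⟨y, hy⟩ := h.low_right_nonempty hG
  obtain ⟨hyB, hmax⟩ := h.recenter_cross hG hx hy
  have hdeg := hmax.le_degIn_center hG
  rw [degIn_erase_self] at hdeg
  exact ⟨_, _, _, hmax.star_of_two_low_left hG (by linarith [hG.one_le_bound y])
    (mem_low_insert_self (by linarith)) (mem_low_insert hz fun hzx => hxz hzx.symm)
    (fun hxz => h.notMem_left (hxz ▸ mem_of_mem_low hz))⟩

theorem MaxTriple.exists_star_of_le (h : G.MaxTriple a b A x B) (hG : G.Counterexample M a b)
    (hx : b x + M x - 1 ≤ G.degIn B x) : ∃ A' x' B', G.Star a b A' x' B' := by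
  classical
  by_cases hA : ∃ z ∈ G.low a A, ¬ G.Adj x z
  · obtain ⟨z, hz, hxz⟩ := hA
    exact h.exists_star_of_not_adj hG hz hxz
  push Not at hA
  have hB {y} (hy : y ∈ G.low b B) : G.Adj x y :=
    h.adj_of_mem_low_right hG (by linarith [hG.one_le_bound x]) hy
  by_cases hcard : 3 ≤ (G.low a A).card + (G.low b B).card
  · exact ⟨A, x, B, h, hA _, hB, hcard⟩
  have hposA := (h.low_left_nonempty hG).card_pos
  have hposB := (h.low_right_nonempty hG).card_pos
  obtain ⟨z, hz⟩ := h.low_left_nonempty hG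
  obtain ⟨y, hBy⟩ := Finset.card_eq_one.mp (show (G.low b B).card = 1 by omega)
  have hy : y ∈ G.low b B := by simp [hBy]
  have hxy := hB hy
  have hxM : b x + G.mult x y - 1 ≤ G.degIn B x := by linarith [hG.mult_le x y]
  have hcases := h.isPivot_or_isLeaf hG hy hxy hxM
  by_cases hyz : G.Adj y z
  · obtain ⟨u, hu, hyu⟩ := hG.symm.exists_adj_left (hcases.elim IsPivot.degIn_eq IsLeaf.degIn_right)
    obtain ⟨v, hv, hvy⟩ :=
      h.right.exists_adj_mem_low_erase hBy ⟨u, Finset.mem_erase.mpr ⟨hyu.ne', hu⟩⟩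
    have hxv : ¬ G.Adj x v := fun hxv =>
      h.notMem_left_of_mem (Finset.mem_of_mem_erase (mem_of_mem_low hv))
        (hG.quads.triangle_unique hxy (hA z hz) hyz hxv hvy.symm ▸ mem_of_mem_low hz)
    exact ⟨_, _, _, h.star_of_not_adj hG hxM hy hxy hv hxv⟩
  · obtain hpivot | hleaf := hcases
    · exact hpivot.maxTriple.exists_star_of_not_adj hG hz hyz
    · exact ⟨_, _, _, hleaf.star hG h hz hyz⟩

theorem Triple.le_degIn_right_or_left (h : G.Triple a b A x B) (hG : G.Counterexample M a b) :
    b x + M x - 1 ≤ G.degIn B x ∨ a x + M x - 1 ≤ G.degIn A x := by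
  have hdeg := h.le_degIn_center hG
  omega

theorem MaxTriple.exists_star (h : G.MaxTriple a b A x B) (hG : G.Counterexample M a b) :
    ∃ A' x' B', G.Star a b A' x' B' := by
  obtain hx | hx := h.le_degIn_right_or_left hG
  · exact h.exists_star_of_le hG hx
  · obtain ⟨A', x', B', hstar⟩ := h.symm.exists_star_of_le hG.symm hx
    exact ⟨B', x', A', hstar.symm⟩

end Star

section MaxStar

/-- A star with the largest total number of low vertices. -/
structure MaxStar (G : Multigraph V) (a b : V → ℤ) (A : Finset V) (x : V) (B : Finset V) :
    Prop extends G.Star a b A x B where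
  card_le : ∀ {A' x' B'}, G.Star a b A' x' B' →
    (G.low a A').card + (G.low b B').card ≤ (G.low a A).card + (G.low b B).card

theorem MaxStar.symm (h : G.MaxStar a b A x B) : G.MaxStar b a B x A where
  toStar := h.toStar.symm
  card_le h' := by linarith [h.card_le h'.symm]

theorem Star.card_low_left_le_one (h : G.Star a b A x B) (hG : QuadsEdgeDisjoint G.toSimpleGraph)
    (hy : y ∈ G.low b B) (hadj : ∀ z ∈ G.low a A, G.Adj y z) : (G.low a A).card ≤ 1 :=
  Finset.card_le_one.mpr fun z hz z' hz' => hG.triangle_unique (h.adj_right hy)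
    (h.adj_left hz) (hadj z hz) (h.adj_left hz') (hadj z' hz')

variable [Fintype V]

theorem Star.exists_not_adj (h : G.Star a b A x B) (hG : G.Counterexample M a b) :
    ∃ y ∈ G.low b B, ∃ z ∈ G.low a A, ¬ G.Adj y z := by
  by_contra! hadj
  obtain ⟨z, hz⟩ := h.low_left_nonempty hG
  obtain ⟨y, hy⟩ := h.low_right_nonempty hG
  have hA := h.card_low_left_le_one hG.quads hy (hadj y hy)
  have hB := h.symm.card_low_left_le_one hG.quads hz fun y hy => (hadj y hy z hz).symm
  linarith [h.three_le_card]

theorem Star.isLeaf [DecidableEq V] (h : G.Star a b A x B) (hG : G.Counterexample M a b)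
    (hx : b x + M x - 1 ≤ G.degIn B x) (hy : y ∈ G.low b B) (hz : z ∈ G.low a A)
    (hyz : ¬ G.Adj y z) : G.IsLeaf a b A x B y :=
  h.isLeaf_of_not_adj hG hy (h.adj_right hy) (by linarith [hG.mult_le x y]) hz hyz

theorem IsLeaf.adj_of_mem_low [DecidableEq V] (hy : G.IsLeaf a b A x B y)
    (hG : G.Counterexample M a b) (hz : z ∈ G.low a A) (hyz : ¬ G.Adj y z)
    (hy' : y' ∈ G.low b B) (hne : y' ≠ y) (hdeg : G.degIn B y' = b y' - 1)
    (hmult : G.mult x y' = 1) (hyy' : G.Adj y y') : G.Adj z y' := by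
  have hy'B := mem_low_erase hy' hne
  have hpos := G.mult_pos_iff.mpr hyy'.symm
  have hlt : G.degIn (B.erase y) x < b x := by
    by_contra! hx
    have hfill := hy.maxTriple.fill hG hx (mem_of_mem_low hy'B)
    rw [degIn_erase hy.mem, G.mult_comm y' x] at hfill
    linarith
  have hpair := hy.maxTriple.maxPair_right hG (by linarith [hy.maxTriple.le_right hG])
  refine hpair.adj hG (mem_low_insert hz fun hzy => hyz hzy.symm) (mem_low.mpr
    ⟨Finset.mem_insert_of_mem (mem_of_mem_low hy'B), ?_⟩)
  rw [degIn_insert (hy.maxTriple.notMem_right), degIn_erase hy.mem, G.mult_comm y' x]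
  linarith

theorem Star.not_adj_of_mem_low (h : G.Star a b A x B) (hG : G.Counterexample M a b)
    (hx : b x + M x - 1 ≤ G.degIn B x) (hy : y ∈ G.low b B) (hy' : y' ∈ G.low b B) :
    ¬ G.Adj y y' := by
  classical
  intro hadj
  obtain ⟨z, hz⟩ := h.low_left_nonempty hG
  have hyz : ¬ G.Adj y z := fun hyz =>
    h.notMem_left_of_mem (mem_of_mem_low hy') (hG.quads.triangle_unique (h.adj_right hy)
      (h.adj_left hz) hyz (h.adj_right hy') hadj ▸ mem_of_mem_low hz)
  have hyz' : ¬ G.Adj y' z := fun hyz' =>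
    h.notMem_left_of_mem (mem_of_mem_low hy) (hG.quads.triangle_unique (h.adj_right hy')
      (h.adj_left hz) hyz' (h.adj_right hy) hadj.symm ▸ mem_of_mem_low hz)
  have hleaf' := h.isLeaf hG hx hy' hz hyz'
  exact hyz' ((h.isLeaf hG hx hy hz hyz).adj_of_mem_low hG hz hyz hy' hadj.ne'
    hleaf'.degIn_right hleaf'.mult_eq_one hadj).symm

theorem MaxStar.not_adj_center [DecidableEq V] (h : G.MaxStar a b A x B)
    (hG : G.Counterexample M a b) (hx : b x + M x - 1 ≤ G.degIn B x) (hy : y ∈ G.low b B)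
    (hv : v ∈ G.low b (B.erase y)) (hvB : v ∉ G.low b B) (hvy : G.Adj v y) : ¬ G.Adj x v := by
  intro hxv
  have hyA := h.notMem_left_of_mem (mem_of_mem_low hy)
  have hvA := h.notMem_left_of_mem (Finset.mem_of_mem_erase (mem_of_mem_low hv))
  have hnadj : ∀ z ∈ G.low a A, ¬ G.Adj y z := fun z hz hyz =>
    hvA (hG.quads.triangle_unique (h.adj_right hy) (h.adj_left hz) hyz hxv hvy.symm ▸
      mem_of_mem_low hz)
  obtain ⟨z, hz⟩ := h.low_left_nonempty hG
  have hleaf := h.isLeaf hG hx hy hz (hnadj z hz)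
  have hcard := h.card_le (hleaf.star hG h.toMaxTriple hz (hnadj z hz))
  have hcardA := card_low_insert hyA (by linarith [hleaf.degIn_left])
    fun z hz hzy => hnadj z hz hzy.symm
  have hcardB := card_low_le_card_low_erase hv hvB
  omega

theorem IsLeaf.of_maxTriple [DecidableEq V] {A' B' : Finset V} (hy : G.IsLeaf a b A x B y)
    (hG : G.Counterexample M a b) (h' : G.MaxTriple a b A' x B') (hyB' : y ∈ B')
    (hA : G.degIn A' y = G.degIn A y) (hB : G.degIn B' y = G.degIn B y) (hx : b x ≤ G.degIn B' x) :
    G.IsLeaf a b A' x B' y :=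
  have hyB := hB.trans hy.degIn_right
  have hyA := hA.trans hy.degIn_left
  ⟨hyB', hy.mult_eq_one, hyB, hyA,
    h'.transfer_of_eq hG hyB' hyB hyA (by rw [hy.mult_eq_one]; linarith)⟩

theorem IsLeaf.adj_of_mem_low_erase_erase [DecidableEq V] (hy : G.IsLeaf a b A x B y)
    (hy' : G.IsLeaf a b A x B y') (hG : G.Counterexample M a b) (h : G.MaxTriple a b A x B)
    (hne : y ≠ y') (hyy' : ¬ G.Adj y y') (hz : z ∈ G.low a A) (hxz : G.Adj x z)
    (hyz : ¬ G.Adj y z) (hyz' : ¬ G.Adj y' z) (hvz : ¬ G.Adj v z)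
    (hv : v ∈ G.low b ((B.erase y).erase y')) : G.Adj x v := by
  have hmax := hy.maxTriple
  have hy'B : y' ∈ B.erase y := Finset.mem_erase.mpr ⟨hne.symm, hy'.mem⟩
  have hyy'' : ¬ G.Adj y' y := fun h => hyy' h.symm
  by_cases hx : b x ≤ G.degIn (B.erase y) x
  · exact (hy'.of_maxTriple hG hmax hy'B (degIn_insert_of_not_adj hyy'')
      (degIn_erase_of_not_adj hyy'') hx).adj_of_mem_low_erase hG hmax hy.mem_low_left hyy'' hv
  have hx : G.degIn (B.erase y) x = b x - 1 := by linarith [hmax.le_right hG]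
  have hzA := mem_low_insert hz fun hzy => hyz hzy.symm
  have hy'low : y' ∈ G.low b (B.erase y) :=
    mem_low_erase (mem_low.mpr ⟨hy'.mem, by linarith [hy'.degIn_right]⟩) hne.symm
  have hleaf := hmax.symm.isLeaf_of_not_adj hG.symm hzA hxz
    (by linarith [hmax.le_degIn_center hG, hG.mult_le x z, hG.one_le_bound x]) hy'low
    fun hzy' => hyz' hzy'.symm
  have hzB := hmax.symm.notMem_left_of_mem hleaf.mem
  have hdegx : b x ≤ G.degIn (insert z (B.erase y)) x := by
    rw [degIn_insert hzB]
    linarith [hleaf.mult_eq_one]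
  have hyz_ne : y ≠ z := fun heq => h.notMem_left_of_mem hy.mem (heq ▸ mem_of_mem_low hz)
  have hleaf' := hy'.of_maxTriple hG hleaf.maxTriple.symm (Finset.mem_insert_of_mem hy'B)
    ((degIn_erase_of_not_adj hyz').trans (degIn_insert_of_not_adj hyy''))
    ((degIn_insert_of_not_adj hyz').trans (degIn_erase_of_not_adj hyy'')) hdegx
  exact hleaf'.adj_of_mem_low_erase hG hleaf.maxTriple.symm
    (mem_low_erase hy.mem_low_left hyz_ne) hyy''
    (mem_low_of_forall_not_adj hv (Finset.erase_subset_erase _ (Finset.subset_insert _ _))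
      (by grind))

theorem Star.eq_of_adj_of_mem_low_erase_erase [DecidableEq V] (h : G.Star a b A x B)
    (hG : G.Counterexample M a b) (hx : b x + M x - 1 ≤ G.degIn B x) (hy : y ∈ G.low b B)
    (hy' : y' ∈ G.low b B) (hv : v ∈ G.low b ((B.erase y).erase y')) (hvy : G.Adj v y)
    (hvy' : G.Adj v y') : y = y' := by
  by_contra! hne
  have hxy := h.adj_right hy
  have hxy' := h.adj_right hy'
  have hvB : v ∈ B := Finset.mem_of_mem_erase (Finset.mem_of_mem_erase (mem_of_mem_low hv))
  have hxv : ¬ G.Adj x v := fun hxv => hne (hG.quads.triangle_unique hxv hxy hvy hxy' hvy')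
  have hvx : v ≠ x := ne_of_mem_of_not_mem hvB h.notMem_right
  have hquad : IsQuad G.toSimpleGraph x y v y' := ⟨hxy, hvy.symm, hvy', hxy'.symm, hvx.symm, hne⟩
  have hquad' : IsQuad G.toSimpleGraph x y' v y :=
    ⟨hxy', hvy'.symm, hvy, hxy.symm, hvx.symm, hne.symm⟩
  obtain ⟨z, hz⟩ := h.low_left_nonempty hG
  have hxz := h.adj_left hz
  have hyz := hG.quads.not_triangle hquad hxz
  have hyz' := hG.quads.not_triangle hquad' hxz
  have hne_z {w} (hw : w ∈ G.low b B) : z ≠ w :=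
    Finset.disjoint_iff_ne.mp h.disjoint z (mem_of_mem_low hz) w (mem_of_mem_low hw)
  have hvz : ¬ G.Adj v z := fun hvz => hne <|
    hG.quads.eq_of_three_common_neighbors hvx.symm hxz hvz hxy hvy hxy' hvy'
      (hne_z hy) (hne_z hy')
  exact hxv ((h.isLeaf hG hx hy hz hyz).adj_of_mem_low_erase_erase (h.isLeaf hG hx hy' hz hyz') hG
    h.toMaxTriple hne (h.not_adj_of_mem_low hG hx hy hy') hz hxz hyz hyz' hvz hv)

theorem Star.exists_adj_mem_low_erase [DecidableEq V] (h : G.Star a b A x B)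
    (hG : G.Counterexample M a b) (hx : b x + M x - 1 ≤ G.degIn B x) :
    ∃ y ∈ G.low b B, ∃ v ∈ G.low b (B.erase y), v ∉ G.low b B ∧ G.Adj v y := by
  obtain ⟨y₀, hy₀, z₀, hz₀, hyz₀⟩ := h.exists_not_adj hG
  have hnonempty : (B \ G.low b B).Nonempty := by
    obtain ⟨u, hu, hyu⟩ := hG.symm.exists_adj_left (h.isLeaf hG hx hy₀ hz₀ hyz₀).degIn_right
    exact ⟨u, Finset.mem_sdiff.mpr ⟨hu, fun hlow => h.not_adj_of_mem_low hG hx hy₀ hlow hyu⟩⟩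
  obtain ⟨v, hv⟩ := (h.right.mono Finset.sdiff_subset).low_nonempty hnonempty
  obtain ⟨hvB, hvlow⟩ := Finset.mem_sdiff.mp (mem_of_mem_low hv)
  have hlow {S : Finset V} (hS : B \ G.low b B ⊆ S) (hSB : S ⊆ B)
      (hadj : ∀ y ∈ G.low b B, y ∈ S → ¬ G.Adj v y) : v ∈ G.low b S :=
    mem_low_of_forall_not_adj hv hS (by grind)
  obtain ⟨y, hy, hvy⟩ : ∃ y ∈ G.low b B, G.Adj v y := by
    by_contra! hadj
    exact hvlow (hlow Finset.sdiff_subset subset_rfl fun y hy _ => hadj y hy)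
  refine ⟨y, hy, v, hlow (by grind) (Finset.erase_subset y B) fun y' hy' hmem hvy' => ?_, hvlow,
    hvy⟩
  have hvx : v ≠ x := ne_of_mem_of_not_mem hvB h.notMem_right
  have hne : y' ≠ y := Finset.ne_of_mem_erase hmem
  have hv' : v ∈ G.low b ((B.erase y).erase y') := by
    refine hlow (by grind) (by grind) fun w hw hmem hvw => ?_
    have hyw : y ≠ w := by grind
    have heq : y' = w := hG.quads.eq_of_three_common_neighbors hvx hvy (h.adj_right hy) hvy'
      (h.adj_right hy') hvw (h.adj_right hw) hne.symm hyw
    grind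
  exact hne (h.eq_of_adj_of_mem_low_erase_erase hG hx hy hy' hv' hvy hvy').symm

theorem MaxStar.exists_triangle [DecidableEq V] (h : G.MaxStar a b A x B)
    (hG : G.Counterexample M a b) (hx : b x + M x - 1 ≤ G.degIn B x) :
    ∃ z y v, G.low a A = {z} ∧ y ∈ G.low b B ∧ G.Adj y z ∧ v ∈ G.low b (B.erase y) ∧
      G.Adj v y := by
  obtain ⟨y, hy, v, hv, hvB, hvy⟩ := h.exists_adj_mem_low_erase hG hx
  have hxv := h.not_adj_center hG hx hy hv hvB hvy
  have hadj : ∀ z ∈ G.low a A, G.Adj y z := fun z hz => by_contra fun hyz =>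
    hxv ((h.isLeaf hG hx hy hz hyz).adj_of_mem_low_erase hG h.toMaxTriple hz hyz hv)
  obtain ⟨z, hz⟩ := h.low_left_nonempty hG
  exact ⟨z, y, v, Finset.eq_singleton_iff_unique_mem.mpr ⟨hz, fun z' hz' =>
    Finset.card_le_one.mp (h.card_low_left_le_one hG.quads hy hadj) z' hz' z hz⟩, hy, hadj z hz,
    hv, hvy⟩

end MaxStar

section Corner

variable [DecidableEq V] {q : V}

/-- The neighbourhood of the centre of a largest star: a net on the triangle `x`, `z`, `y` with
`z` the only low vertex of `A` and `y`, `q` low in `B`, whose pendants `u` and `v` at `z` and `y`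
become low when these vertices are removed. -/
structure Corner (G : Multigraph V) (M a b : V → ℤ) (A : Finset V) (x : V) (B : Finset V)
    (z y q u v : V) : Prop extends G.MaxStar a b A x B where
  le_degIn : b x + M x - 1 ≤ G.degIn B x
  isNet : IsNet G.toSimpleGraph ![x, z, y] ![q, u, v]
  low_left : G.low a A = {z}
  mem_y : y ∈ G.low b B
  mem_q : q ∈ G.low b B
  mem_u : u ∈ G.low a (A.erase z)
  mem_v : v ∈ G.low b (B.erase y)

theorem Corner.adj_xy (c : G.Corner M a b A x B z y q u v) : G.Adj x y := c.adj_right c.mem_y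

theorem Corner.mem_z (c : G.Corner M a b A x B z y q u v) : z ∈ G.low a A := by simp [c.low_left]

theorem Corner.adj_xz (c : G.Corner M a b A x B z y q u v) : G.Adj x z := c.adj_left c.mem_z

variable [Fintype V]

theorem MaxStar.exists_corner (h : G.MaxStar a b A x B) (hG : G.Counterexample M a b)
    (hx : b x + M x - 1 ≤ G.degIn B x) : ∃ z y q u v, G.Corner M a b A x B z y q u v := by
  obtain ⟨z, y, v, hlow, hy, hyz, hv, hvy⟩ := h.exists_triangle hG hx
  have hz : z ∈ G.low a A := by simp [hlow]
  have hxz := h.adj_left hz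
  have hxy := h.adj_right hy
  have hcard : 1 < (G.low b B).card := by
    have hthree := h.three_le_card
    rw [hlow, Finset.card_singleton] at hthree
    omega
  obtain ⟨q, hq, hqy⟩ := Finset.exists_mem_ne hcard y
  have hxq := h.adj_right hq
  have hqz : ¬ G.Adj q z := fun hqz =>
    hqy (hG.quads.triangle_unique hxz hxq hqz.symm hxy hyz.symm)
  obtain ⟨t, ht, hqt⟩ := hG.exists_adj_left (h.isLeaf hG hx hq hz hqz).degIn_left
  obtain ⟨u, hu, huz⟩ := h.left.exists_adj_mem_low_erase hlow
    ⟨t, Finset.mem_erase.mpr ⟨fun htz => hqz (htz ▸ hqt), ht⟩⟩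
  have hzA := mem_of_mem_low hz
  have hyB := mem_of_mem_low hy
  have hqB := mem_of_mem_low hq
  have huA := Finset.mem_of_mem_erase (mem_of_mem_low hu)
  have hvB := Finset.mem_of_mem_erase (mem_of_mem_low hv)
  have hne := Finset.disjoint_iff_ne.mp h.disjoint
  refine ⟨z, y, q, u, v, h, hx, ⟨?_, ?_, ?_⟩, hlow, hy, hq, hu, hv⟩
  · simp [Fin.forall_fin_succ, hxz, hxy, hyz, hxz.symm, hxy.symm, hyz.symm]
  · simp [Fin.forall_fin_succ, hxq, huz.symm, hvy.symm]
  · simp only [Fin.forall_fin_succ, Matrix.cons_val_zero, Matrix.cons_val_succ,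
      Matrix.cons_val_fin_one, forall_const]
    grind [h.notMem_left, h.notMem_right, huz.ne, hvy.ne]

namespace Corner

theorem not_adj_xu (c : G.Corner M a b A x B z y q u v) (hG : G.Counterexample M a b) :
    ¬ G.Adj x u := c.isNet.not_adj_pendant (i := 0) (j := 1) hG.quads (by decide)

theorem not_adj_xv (c : G.Corner M a b A x B z y q u v) (hG : G.Counterexample M a b) :
    ¬ G.Adj x v := c.isNet.not_adj_pendant (i := 0) (j := 2) hG.quads (by decide)

theorem not_adj_zq (c : G.Corner M a b A x B z y q u v) (hG : G.Counterexample M a b) :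
    ¬ G.Adj z q := c.isNet.not_adj_pendant (i := 1) (j := 0) hG.quads (by decide)

theorem not_adj_zv (c : G.Corner M a b A x B z y q u v) (hG : G.Counterexample M a b) :
    ¬ G.Adj z v := c.isNet.not_adj_pendant (i := 1) (j := 2) hG.quads (by decide)

theorem not_adj_yq (c : G.Corner M a b A x B z y q u v) (hG : G.Counterexample M a b) :
    ¬ G.Adj y q := c.isNet.not_adj_pendant (i := 2) (j := 0) hG.quads (by decide)

theorem not_adj_yu (c : G.Corner M a b A x B z y q u v) (hG : G.Counterexample M a b) :
    ¬ G.Adj y u := c.isNet.not_adj_pendant (i := 2) (j := 1) hG.quads (by decide)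

theorem isLeaf (c : G.Corner M a b A x B z y q u v) (hG : G.Counterexample M a b) :
    G.IsLeaf a b A x B q :=
  c.toStar.isLeaf hG c.le_degIn c.mem_q c.mem_z fun h => c.not_adj_zq hG h.symm

theorem degIn_right (c : G.Corner M a b A x B z y q u v) (hG : G.Counterexample M a b) :
    G.degIn (B.erase y) x = b x - 1 :=
  (c.recenter_of_not_adj hG (by linarith [c.le_degIn, hG.mult_le x y]) c.mem_y c.adj_xy c.mem_v
    (c.not_adj_xv hG)).1

theorem star_right (c : G.Corner M a b A x B z y q u v) (hG : G.Counterexample M a b) :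
    G.Star a b A y (insert x (B.erase y)) :=
  c.star_of_not_adj hG (by linarith [c.le_degIn, hG.mult_le x y]) c.mem_y c.adj_xy c.mem_v
    (c.not_adj_xv hG)

theorem le_degIn_left (c : G.Corner M a b A x B z y q u v) (hG : G.Counterexample M a b) :
    a x + G.mult x z - 1 ≤ G.degIn (insert q A) x := by
  have hright := c.degIn_right hG
  rw [degIn_erase (mem_of_mem_low c.mem_y)] at hright
  rw [degIn_insert (c.notMem_left_of_mem (mem_of_mem_low c.mem_q)), (c.isLeaf hG).mult_eq_one]
  linarith [c.le_degIn_center hG, hG.mult_le x y, hG.mult_le x z]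

theorem mem_z_insert (c : G.Corner M a b A x B z y q u v) (hG : G.Counterexample M a b) :
    z ∈ G.low a (insert q A) := mem_low_insert c.mem_z (c.not_adj_zq hG)

theorem mem_u_insert (c : G.Corner M a b A x B z y q u v) (hG : G.Counterexample M a b) :
    u ∈ G.low a ((insert q A).erase z) := by
  have hqz : q ≠ z := (c.isNet.ne_pendant 1 0).symm
  rw [Finset.erase_insert_of_ne hqz]
  exact mem_low_insert c.mem_u (c.isNet.not_adj_pendants hG.quads 1 0)

theorem degIn_left (c : G.Corner M a b A x B z y q u v) (hG : G.Counterexample M a b) :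
    G.degIn (A.erase z) x = a x - 2 := by
  have hleft := ((c.isLeaf hG).maxTriple.symm.recenter_of_not_adj hG.symm (c.le_degIn_left hG)
    (c.mem_z_insert hG) c.adj_xz (c.mem_u_insert hG) (c.not_adj_xu hG)).1
  rw [degIn_erase (mem_of_mem_low (c.mem_z_insert hG)),
    degIn_insert (c.notMem_left_of_mem (mem_of_mem_low c.mem_q)),
    (c.isLeaf hG).mult_eq_one] at hleft
  rw [degIn_erase (mem_of_mem_low c.mem_z)]
  linarith

theorem star_left (c : G.Corner M a b A x B z y q u v) (hG : G.Counterexample M a b) :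
    G.Star b a (B.erase q) z (insert x ((insert q A).erase z)) :=
  (c.isLeaf hG).maxTriple.symm.star_of_not_adj hG.symm (c.le_degIn_left hG)
    (c.mem_z_insert hG) c.adj_xz (c.mem_u_insert hG) (c.not_adj_xu hG)

theorem low_right_subset (c : G.Corner M a b A x B z y q u v) (hG : G.Counterexample M a b) :
    G.low b B ⊆ {y, q} := by
  intro p hp
  by_cases hpq : p = q
  · simp [hpq]
  have hzp : G.Adj z p := (c.star_left hG).adj_left (mem_low_erase hp hpq)
  have hzy : G.Adj z y := c.isNet.adj (i := 1) (j := 2) (by decide)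
  simp [hG.quads.triangle_unique c.adj_xz (c.adj_right hp) hzp c.adj_xy hzy]

theorem maxStar_of_star {A' B' : Finset V} {x' : V} (c : G.Corner M a b A x B z y q u v)
    (hG : G.Counterexample M a b) (h : G.Star a b A' x' B') : G.MaxStar a b A' x' B' where
  toStar := h
  card_le h' := by
    have hle := c.card_le h'
    have hright := (Finset.card_le_card (c.low_right_subset hG)).trans Finset.card_le_two
    rw [c.low_left, Finset.card_singleton] at hle
    linarith [h.three_le_card]

end Corner

theorem MaxStar.exists_corner_of_not_adj (h : G.MaxStar a b A x B)
    (hG : G.Counterexample M a b) (hz : z ∈ G.low a A) (hy : y ∈ G.low b B) (hq : q ∈ G.low b B)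
    (hyq : y ≠ q) (hqz : ¬ G.Adj q z) : ∃ u v, G.Corner M a b A x B z y q u v := by
  obtain hx | hx := h.le_degIn_right_or_left hG
  · obtain ⟨z', y', q', u, v, c⟩ := h.exists_corner hG hx
    obtain rfl : z = z' := by simpa [c.low_left] using hz
    have hyz' : G.Adj y' z := c.isNet.adj (i := 2) (j := 1) (by decide)
    have hy' := c.low_right_subset hG hy
    have hq' := c.low_right_subset hG hq
    obtain ⟨rfl, rfl⟩ : y = y' ∧ q = q' := by grind
    exact ⟨u, v, c⟩
  · obtain ⟨z', _, _, _, _, c⟩ := h.symm.exists_corner hG.symm hx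
    simp only [c.low_left, Finset.mem_singleton] at hy hq
    exact absurd (hy.trans hq.symm) hyq

end Corner

section NetPartition

/-- A partition of the vertices into two degenerate sets and the six vertices of a net, with the
degrees that make every distribution of the net over the two sets a maximum triple. -/
structure NetPartition (G : Multigraph V) (a b : V → ℤ) (A B : Finset V) (p q : Fin 3 → V) :
    Prop where
  isNet : IsNet G.toSimpleGraph p q
  left : G.Degenerate a A
  right : G.Degenerate b B
  disjoint : Disjoint A B
  cover : ∀ v, v ∈ A ∨ v ∈ B ∨ (∃ i, v = p i) ∨ ∃ i, v = q i
  notMem_left : ∀ i, p i ∉ A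
  notMem_right : ∀ i, p i ∉ B
  pendant_notMem_left : ∀ i, q i ∉ A
  pendant_notMem_right : ∀ i, q i ∉ B
  mult_pendant : ∀ i, G.mult (p i) (q i) = 1
  degIn_left : ∀ i, G.degIn A (p i) = a (p i) - 2
  degIn_right : ∀ i, G.degIn B (p i) = b (p i) - 2
  degIn_pendant_left : ∀ i, G.degIn A (q i) = a (q i) - 1
  degIn_pendant_right : ∀ i, G.degIn B (q i) = b (q i) - 1

namespace NetPartition

variable {p q : Fin 3 → V} {i j k : Fin 3}

theorem symm (c : G.NetPartition a b A B p q) : G.NetPartition b a B A p q where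
  isNet := c.isNet
  left := c.right
  right := c.left
  disjoint := c.disjoint.symm
  cover v := or_left_comm.mp (c.cover v)
  notMem_left := c.notMem_right
  notMem_right := c.notMem_left
  pendant_notMem_left := c.pendant_notMem_right
  pendant_notMem_right := c.pendant_notMem_left
  mult_pendant := c.mult_pendant
  degIn_left := c.degIn_right
  degIn_right := c.degIn_left
  degIn_pendant_left := c.degIn_pendant_right
  degIn_pendant_right := c.degIn_pendant_left

variable [DecidableEq V]

theorem pendant_notMem_insert (c : G.NetPartition a b A B p q) (j : Fin 3) :
    q j ∉ insert (p j) A :=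
  Finset.mem_insert.not.mpr (not_or.mpr ⟨(c.isNet.ne_pendant j j).symm, c.pendant_notMem_left j⟩)

theorem degIn_insert_pendant (c : G.NetPartition a b A B p q) (j : Fin 3) :
    G.degIn (insert (p j) A) (q j) = a (q j) := by
  rw [degIn_insert (c.notMem_left j), c.degIn_pendant_left, G.mult_comm, c.mult_pendant]
  ring

theorem degenerate_insert_insert (c : G.NetPartition a b A B p q) (j : Fin 3) :
    G.Degenerate a (insert (q j) (insert (p j) A)) := by
  rw [Finset.insert_comm]
  refine (c.left.insert (by linarith [c.degIn_pendant_left j])).insert ?_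
  rw [degIn_insert (c.pendant_notMem_left j), c.degIn_left, c.mult_pendant]
  linarith

theorem energy_insert_insert (c : G.NetPartition a b A B p q) (j : Fin 3) :
    G.energy a (insert (q j) (insert (p j) A)) = G.energy a A - 4 := by
  rw [energy_insert (c.pendant_notMem_insert j), energy_insert (c.notMem_left j),
    c.degIn_insert_pendant, c.degIn_left]
  ring

theorem degIn_insert_insert (c : G.NetPartition a b A B p q)
    (hG : QuadsEdgeDisjoint G.toSimpleGraph) (hij : i ≠ j) :
    G.degIn (insert (q j) (insert (p j) A)) (p i) = a (p i) - 2 + G.mult (p i) (p j) := by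
  rw [degIn_insert_of_not_adj (c.isNet.not_adj_pendant hG hij), degIn_insert (c.notMem_left j),
    c.degIn_left]

theorem degIn_insert_insert_pendant (c : G.NetPartition a b A B p q)
    (hG : QuadsEdgeDisjoint G.toSimpleGraph) (hij : i ≠ j) :
    G.degIn (insert (q j) (insert (p j) A)) (q i) = a (q i) - 1 := by
  rw [degIn_insert_of_not_adj (c.isNet.not_adj_pendants hG i j),
    degIn_insert_of_not_adj fun h => c.isNet.not_adj_pendant hG hij.symm h.symm,
    c.degIn_pendant_left]

theorem pendant_notMem_insert_insert (c : G.NetPartition a b A B p q)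
    (hG : QuadsEdgeDisjoint G.toSimpleGraph) (hij : i ≠ j) :
    q i ∉ insert (q j) (insert (p j) A) := by
  simp [c.isNet.pendant_ne hG hij, (c.isNet.ne_pendant j i).symm, c.pendant_notMem_left i]

theorem triple (c : G.NetPartition a b A B p q) (hG : QuadsEdgeDisjoint G.toSimpleGraph)
    (hij : i ≠ j) (hik : i ≠ k) (hjk : j ≠ k) :
    G.Triple a b (insert (q j) (insert (p j) A)) (p i)
      (insert (q i) (insert (q k) (insert (p k) B))) where
  notMem_left := by
    simp [c.isNet.ne_pendant i j, (c.isNet.adj hij).ne, c.notMem_left i]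
  notMem_right := by
    simp [c.isNet.ne_pendant i i, c.isNet.ne_pendant i k, (c.isNet.adj hik).ne, c.notMem_right i]
  disjoint := by
    simp [c.isNet.pendant_ne hG hij, c.isNet.pendant_ne hG hjk.symm, (c.isNet.adj hjk.symm).ne,
      (c.isNet.ne_pendant j i).symm, (c.isNet.ne_pendant j k).symm, c.isNet.ne_pendant k j,
      c.notMem_left k, c.notMem_right j, c.pendant_notMem_left i, c.pendant_notMem_left k,
      c.pendant_notMem_right j, c.disjoint]
  eq_or_mem_or_mem v := by
    have hcases (m : Fin 3) : m = i ∨ m = j ∨ m = k := by omega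
    simp only [Finset.mem_insert]
    rcases c.cover v with h | h | ⟨m, rfl⟩ | ⟨m, rfl⟩
    · tauto
    · tauto
    · rcases hcases m with rfl | rfl | rfl <;> tauto
    · rcases hcases m with rfl | rfl | rfl <;> tauto
  left := c.degenerate_insert_insert j
  right := (c.symm.degenerate_insert_insert k).insert
    (by linarith [c.symm.degIn_insert_insert_pendant hG hik])

theorem degIn_insert_insert_insert (c : G.NetPartition a b A B p q)
    (hG : QuadsEdgeDisjoint G.toSimpleGraph) (hik : i ≠ k) :
    G.degIn (insert (q i) (insert (q k) (insert (p k) B))) (p i) =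
      b (p i) - 1 + G.mult (p i) (p k) := by
  rw [degIn_insert (c.symm.pendant_notMem_insert_insert hG hik),
    c.symm.degIn_insert_insert hG hik, c.mult_pendant]
  ring

theorem potential_eq (c : G.NetPartition a b A B p q) (hG : QuadsEdgeDisjoint G.toSimpleGraph)
    (hij : i ≠ j) (hik : i ≠ k) :
    G.potential a b (insert (q j) (insert (p j) A)) (p i)
      (insert (q i) (insert (q k) (insert (p k) B))) = G.energy a A + G.energy b B - 10 := by
  have hpij := G.mult_pos_iff.mpr (c.isNet.adj hij)
  have hpik := G.mult_pos_iff.mpr (c.isNet.adj hik)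
  rw [potential_eq_of_le, c.energy_insert_insert,
    energy_insert (c.symm.pendant_notMem_insert_insert hG hik), c.symm.energy_insert_insert,
    c.symm.degIn_insert_insert_pendant hG hik]
  · ring
  · linarith [c.degIn_insert_insert hG hij]
  · linarith [c.degIn_insert_insert_insert hG hik]

theorem mem_low_right (c : G.NetPartition a b A B p q) (hG : QuadsEdgeDisjoint G.toSimpleGraph)
    (hik : i ≠ k) : p k ∈ G.low b (insert (q i) (insert (q k) (insert (p k) B))) := by
  refine mem_low.mpr ⟨by simp, ?_⟩
  rw [degIn_insert_of_not_adj (c.isNet.not_adj_pendant hG hik.symm), Finset.insert_comm,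
    degIn_insert_self, degIn_insert (c.pendant_notMem_right k), c.degIn_right, c.mult_pendant]
  linarith

theorem pendant_mem_low_right (c : G.NetPartition a b A B p q)
    (hG : QuadsEdgeDisjoint G.toSimpleGraph) (hik : i ≠ k) :
    q i ∈ G.low b (insert (q i) (insert (q k) (insert (p k) B))) :=
  mem_low_insert_self (by linarith [c.symm.degIn_insert_insert_pendant hG hik])

end NetPartition

variable {p q : Fin 3 → V} {i j k : Fin 3}

/-- A net partition all of whose distributions have maximum potential. -/
structure MaxNetPartition (G : Multigraph V) (a b : V → ℤ) (A B : Finset V) (p q : Fin 3 → V) :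
    Prop extends G.NetPartition a b A B p q where
  potential_le : ∀ {A' x' B'}, G.Triple a b A' x' B' →
    G.potential a b A' x' B' ≤ G.energy a A + G.energy b B - 10

namespace MaxNetPartition

theorem symm (c : G.MaxNetPartition a b A B p q) : G.MaxNetPartition b a B A p q where
  toNetPartition := c.toNetPartition.symm
  potential_le h := by
    rw [potential_symm, add_comm]
    exact c.potential_le h.symm

theorem maxTriple [DecidableEq V] (c : G.MaxNetPartition a b A B p q)
    (hG : QuadsEdgeDisjoint G.toSimpleGraph) (hij : i ≠ j) (hik : i ≠ k) (hjk : j ≠ k) :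
    G.MaxTriple a b (insert (q j) (insert (p j) A)) (p i)
      (insert (q i) (insert (q k) (insert (p k) B))) where
  toTriple := c.triple hG hij hik hjk
  potential_le h := (c.potential_le h).trans_eq (c.potential_eq hG hij hik).symm

variable [Fintype V]

theorem adj_of_not_adj (c : G.MaxNetPartition a b A B p q) (hG : G.Counterexample M a b)
    (hz : z ∈ G.low a A) (hij : i ≠ j) (hik : i ≠ k) (hjk : j ≠ k) (hzp : ¬ G.Adj z (p j))
    (hzq : ¬ G.Adj z (q j)) : G.Adj (p i) z := by
  classical
  exact (c.maxTriple hG.quads hij hik hjk).adj_of_two_low hG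
    (mem_low_insert (mem_low_insert hz hzp) hzq) (c.mem_low_right hG.quads hik)
    (c.pendant_mem_low_right hG.quads hik) (c.isNet.ne_pendant k i)

theorem adj_or_adj_pendant (c : G.MaxNetPartition a b A B p q) (hG : G.Counterexample M a b)
    (hz : z ∈ G.low a A) (hij : i ≠ j) (hik : i ≠ k) (hjk : j ≠ k) :
    G.Adj z (p j) ∨ G.Adj z (q j) := by
  by_contra! h
  have hi := c.adj_of_not_adj hG hz hij hik hjk h.1 h.2
  have hk := c.adj_of_not_adj hG hz hjk.symm hik.symm hij.symm h.1 h.2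
  exact ne_of_mem_of_not_mem (mem_of_mem_low hz) (c.notMem_left j)
    (hG.quads.triangle_unique (c.isNet.adj hik) hi hk (c.isNet.adj hij) (c.isNet.adj hjk.symm))

theorem adj_pendant (c : G.MaxNetPartition a b A B p q) (hG : G.Counterexample M a b)
    (hz : z ∈ G.low a A) (hij : i ≠ j) (hik : i ≠ k) (hjk : j ≠ k) : G.Adj z (q j) := by
  have hzp (m : Fin 3) : z ≠ p m := ne_of_mem_of_not_mem (mem_of_mem_low hz) (c.notMem_left m)
  refine (c.adj_or_adj_pendant hG hz hij hik hjk).resolve_left fun hj => ?_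
  obtain hi | hi := c.adj_or_adj_pendant hG hz hij.symm hjk hik
  · exact hzp k (hG.quads.triangle_unique (c.isNet.adj hij) hi.symm hj.symm (c.isNet.adj hik)
      (c.isNet.adj hjk))
  · exact hG.quads.not_triangle ⟨c.isNet.adj hij, hj.symm, hi, (c.isNet.adj_pendant i).symm,
      (hzp i).symm, c.isNet.ne_pendant j i⟩ (c.isNet.adj hik) (c.isNet.adj hjk)

theorem exists_adj_pendants (c : G.MaxNetPartition a b A B p q) (hG : G.Counterexample M a b) :
    ∃ z ∈ A, ∀ j, G.Adj z (q j) := by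
  obtain ⟨u, hu, -⟩ := hG.exists_adj_left (c.degIn_pendant_left 0)
  obtain ⟨z, hz⟩ := c.left.low_nonempty ⟨u, hu⟩
  refine ⟨z, mem_of_mem_low hz, fun j => ?_⟩
  obtain ⟨i, hji, -⟩ := exists_ne_ne j j
  obtain ⟨k, hik, hjk⟩ := exists_ne_ne i j
  exact c.adj_pendant hG hz hji.symm hik hjk

theorem false (c : G.MaxNetPartition a b A B p q) (hG : G.Counterexample M a b) : False := by
  obtain ⟨z, hzA, hz⟩ := c.exists_adj_pendants hG
  obtain ⟨y, hyB, hy⟩ := c.symm.exists_adj_pendants hG.symm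
  have hne {i j : Fin 3} (hij : i ≠ j) : q i ≠ q j := c.isNet.pendant_ne hG.quads hij
  exact hne (by decide) (hG.quads.eq_of_three_common_neighbors
    (Finset.disjoint_iff_ne.mp c.disjoint z hzA y hyB) (hz 0) (hy 0) (hz 1) (hy 1) (hz 2) (hy 2)
    (hne (by decide)) (hne (by decide)))

end MaxNetPartition

end NetPartition

section Corner

variable [DecidableEq V] {q : V}

namespace Corner

theorem notMem_net_left (c : G.Corner M a b A x B z y q u v) (i : Fin 3) :
    ![x, z, y] i ∉ (A.erase z).erase u := by
  have hy := c.notMem_left_of_mem (mem_of_mem_low c.mem_y)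
  match i with
  | 0 => change x ∉ _; grind [c.notMem_left]
  | 1 => change z ∉ _; grind
  | 2 => change y ∉ _; grind

theorem notMem_net_right (c : G.Corner M a b A x B z y q u v) (i : Fin 3) :
    ![x, z, y] i ∉ ((B.erase y).erase q).erase v := by
  have hz := c.symm.notMem_left_of_mem (mem_of_mem_low c.mem_z)
  match i with
  | 0 => change x ∉ _; grind [c.notMem_right]
  | 1 => change z ∉ _; grind
  | 2 => change y ∉ _; grind

theorem pendant_notMem_net_left (c : G.Corner M a b A x B z y q u v) (i : Fin 3) :
    ![q, u, v] i ∉ (A.erase z).erase u :=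
  match i with
  | 0 => by change q ∉ _; grind [c.notMem_left_of_mem (mem_of_mem_low c.mem_q)]
  | 1 => by change u ∉ _; grind
  | 2 => by change v ∉ _; grind [mem_of_mem_low c.mem_v, Finset.disjoint_left, c.disjoint]

theorem pendant_notMem_net_right (c : G.Corner M a b A x B z y q u v) (i : Fin 3) :
    ![q, u, v] i ∉ ((B.erase y).erase q).erase v :=
  match i with
  | 0 => by change q ∉ _; grind
  | 1 => by change u ∉ _; grind [mem_of_mem_low c.mem_u, Finset.disjoint_left, c.disjoint]
  | 2 => by change v ∉ _; grind

variable [Fintype V]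

theorem exists_corner_right (c : G.Corner M a b A x B z y q u v) (hG : G.Counterexample M a b) :
    ∃ u' v', G.Corner M a b A y (insert x (B.erase y)) z x v u' v' :=
  (c.maxStar_of_star hG (c.star_right hG)).exists_corner_of_not_adj hG c.mem_z
    (mem_low_insert_self (by linarith [c.degIn_right hG]))
    (mem_low_insert c.mem_v fun h => c.not_adj_xv hG h.symm) (c.isNet.ne_pendant 0 2)
    fun h => c.not_adj_zv hG h.symm

theorem degIn_insert_erase_left (c : G.Corner M a b A x B z y q u v)
    (hG : G.Counterexample M a b) : G.degIn ((insert q A).erase z) x = a x - 1 := by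
  have hqz : q ≠ z := (c.isNet.ne_pendant 1 0).symm
  have hqA : q ∉ A.erase z := fun h =>
    c.notMem_left_of_mem (mem_of_mem_low c.mem_q) (Finset.mem_of_mem_erase h)
  rw [Finset.erase_insert_of_ne hqz, degIn_insert hqA, c.degIn_left hG,
    (c.isLeaf hG).mult_eq_one]
  ring

theorem exists_corner_left (c : G.Corner M a b A x B z y q u v) (hG : G.Counterexample M a b) :
    ∃ u' v', G.Corner M b a (B.erase q) z (insert x ((insert q A).erase z)) y x u u' v' :=
  (c.maxStar_of_star hG (c.star_left hG).symm).symm.exists_corner_of_not_adj hG.symm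
    (mem_low_erase c.mem_y (c.isNet.ne_pendant 2 0))
    (mem_low_insert_self (by linarith [c.degIn_insert_erase_left hG]))
    (mem_low_insert (c.mem_u_insert hG) fun h => c.not_adj_xu hG h.symm) (c.isNet.ne_pendant 0 1)
    fun h => c.not_adj_yu hG h.symm

theorem isLeaf_right (c : G.Corner M a b A x B z y q u v) (hG : G.Counterexample M a b) :
    G.IsLeaf a b A y (insert x (B.erase y)) v :=
  let ⟨_, _, c'⟩ := c.exists_corner_right hG
  c'.isLeaf hG

theorem isLeaf_left (c : G.Corner M a b A x B z y q u v) (hG : G.Counterexample M a b) :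
    G.IsLeaf b a (B.erase q) z (insert x ((insert q A).erase z)) u :=
  let ⟨_, _, c'⟩ := c.exists_corner_left hG
  c'.isLeaf hG.symm

theorem degIn_net_left (c : G.Corner M a b A x B z y q u v) (hG : G.Counterexample M a b)
    (i : Fin 3) : G.degIn ((A.erase z).erase u) (![x, z, y] i) = a (![x, z, y] i) - 2 := by
  obtain ⟨_, _, cy⟩ := c.exists_corner_right hG
  obtain ⟨_, _, cz⟩ := c.exists_corner_left hG
  match i with
  | 0 => exact (degIn_erase_of_not_adj (c.not_adj_xu hG)).trans (c.degIn_left hG)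
  | 1 =>
    have hz := cz.degIn_right hG.symm
    rw [Finset.erase_insert ((c.isLeaf hG).maxTriple.symm.notMem_erase z), degIn_erase_self,
      degIn_insert_of_not_adj (c.not_adj_zq hG)] at hz
    change G.degIn ((A.erase z).erase u) z = a z - 2
    rw [degIn_erase (mem_of_mem_low c.mem_u), degIn_erase_self, hz, (c.isLeaf_left hG).mult_eq_one]
    ring
  | 2 => exact (degIn_erase_of_not_adj (c.not_adj_yu hG)).trans (cy.degIn_left hG)

theorem degIn_net_right (c : G.Corner M a b A x B z y q u v) (hG : G.Counterexample M a b)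
    (i : Fin 3) :
    G.degIn (((B.erase y).erase q).erase v) (![x, z, y] i) = b (![x, z, y] i) - 2 := by
  obtain ⟨_, _, cy⟩ := c.exists_corner_right hG
  obtain ⟨_, _, cz⟩ := c.exists_corner_left hG
  match i with
  | 0 =>
    have hq : q ∈ G.low b (B.erase y) := mem_low_erase c.mem_q (c.isNet.ne_pendant 2 0).symm
    refine (degIn_erase_of_not_adj (c.not_adj_xv hG)).trans ?_
    change G.degIn ((B.erase y).erase q) x = b x - 2
    rw [degIn_erase (mem_of_mem_low hq), c.degIn_right hG, (c.isLeaf hG).mult_eq_one]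
    ring
  | 1 =>
    refine (degIn_erase_of_not_adj (c.not_adj_zv hG)).trans ?_
    rw [Finset.erase_right_comm]
    exact cz.degIn_left hG.symm
  | 2 =>
    have hy := cy.degIn_right hG
    rw [Finset.erase_insert (c.notMem_erase y)] at hy
    change G.degIn (((B.erase y).erase q).erase v) y = b y - 2
    rw [Finset.erase_right_comm, degIn_erase_of_not_adj (c.not_adj_yq hG),
      degIn_erase (mem_of_mem_low c.mem_v), hy, (c.isLeaf_right hG).mult_eq_one]
    ring

theorem degIn_pendant_left (c : G.Corner M a b A x B z y q u v) (hG : G.Counterexample M a b)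
    (i : Fin 3) : G.degIn ((A.erase z).erase u) (![q, u, v] i) = a (![q, u, v] i) - 1 := by
  have hpendant (j : Fin 3) : ¬ G.Adj (![q, u, v] i) (![q, u, v] j) :=
    c.isNet.not_adj_pendants hG.quads i j
  have hnet {j : Fin 3} (hij : i ≠ j) : ¬ G.Adj (![q, u, v] i) (![x, z, y] j) := fun h =>
    c.isNet.not_adj_pendant hG.quads hij.symm h.symm
  refine (degIn_erase_of_not_adj (hpendant 1)).trans ?_
  match i with
  | 0 => exact (degIn_erase_of_not_adj (hnet (j := 1) (by decide))).trans (c.isLeaf hG).degIn_left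
  | 1 =>
    have hqz : q ≠ z := (c.isNet.ne_pendant 1 0).symm
    have hu := (degIn_insert_of_not_adj (hnet (j := 0) (by decide))).symm.trans
      (c.isLeaf_left hG).degIn_right
    rw [Finset.erase_insert_of_ne hqz] at hu
    exact (degIn_insert_of_not_adj (hpendant 0)).symm.trans hu
  | 2 =>
    exact (degIn_erase_of_not_adj (hnet (j := 1) (by decide))).trans (c.isLeaf_right hG).degIn_left

theorem degIn_pendant_right (c : G.Corner M a b A x B z y q u v) (hG : G.Counterexample M a b)
    (i : Fin 3) :
    G.degIn (((B.erase y).erase q).erase v) (![q, u, v] i) = b (![q, u, v] i) - 1 := by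
  have hpendant (j : Fin 3) : ¬ G.Adj (![q, u, v] i) (![q, u, v] j) :=
    c.isNet.not_adj_pendants hG.quads i j
  have hnet {j : Fin 3} (hij : i ≠ j) : ¬ G.Adj (![q, u, v] i) (![x, z, y] j) := fun h =>
    c.isNet.not_adj_pendant hG.quads hij.symm h.symm
  refine (degIn_erase_of_not_adj (hpendant 2)).trans ?_
  refine (degIn_erase_of_not_adj (hpendant 0)).trans ?_
  match i with
  | 0 => exact (degIn_erase_of_not_adj (hnet (j := 2) (by decide))).trans (c.isLeaf hG).degIn_right
  | 1 =>
    refine (degIn_erase_of_not_adj (hnet (j := 2) (by decide))).trans ?_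
    exact (degIn_erase_of_not_adj (hpendant 0)).symm.trans (c.isLeaf_left hG).degIn_left
  | 2 =>
    exact (degIn_insert_of_not_adj (hnet (j := 0) (by decide))).symm.trans
      (c.isLeaf_right hG).degIn_right

theorem netPartition (c : G.Corner M a b A x B z y q u v) (hG : G.Counterexample M a b) :
    G.NetPartition a b ((A.erase z).erase u) (((B.erase y).erase q).erase v) ![x, z, y]
      ![q, u, v] where
  isNet := c.isNet
  left := c.left.mono (by grind)
  right := c.right.mono (by grind)
  disjoint := c.disjoint.mono (by grind) (by grind)
  cover w := by
    simp only [Finset.mem_erase, Fin.exists_fin_succ, Matrix.cons_val_zero, Matrix.cons_val_succ,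
      Matrix.cons_val_fin_one, exists_const]
    grind [c.eq_or_mem_or_mem w]
  notMem_left := c.notMem_net_left
  notMem_right := c.notMem_net_right
  pendant_notMem_left := c.pendant_notMem_net_left
  pendant_notMem_right := c.pendant_notMem_net_right
  mult_pendant i := by
    match i with
    | 0 => exact (c.isLeaf hG).mult_eq_one
    | 1 => exact (c.isLeaf_left hG).mult_eq_one
    | 2 => exact (c.isLeaf_right hG).mult_eq_one
  degIn_left := c.degIn_net_left hG
  degIn_right := c.degIn_net_right hG
  degIn_pendant_left := c.degIn_pendant_left hG
  degIn_pendant_right := c.degIn_pendant_right hG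

theorem maxNetPartition (c : G.Corner M a b A x B z y q u v) (hG : G.Counterexample M a b) :
    G.MaxNetPartition a b ((A.erase z).erase u) (((B.erase y).erase q).erase v) ![x, z, y]
      ![q, u, v] where
  toNetPartition := c.netPartition hG
  potential_le h := by
    have hA : insert u (insert z ((A.erase z).erase u)) = A := by
      grind [mem_of_mem_low c.mem_z, mem_of_mem_low c.mem_u]
    have hB : insert q (insert v (insert y (((B.erase y).erase q).erase v))) = B := by
      grind [mem_of_mem_low c.mem_y, mem_of_mem_low c.mem_q, mem_of_mem_low c.mem_v]
    have hpot := (c.netPartition hG).potential_eq hG.quads (i := 0) (j := 1) (k := 2)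
      (by decide) (by decide)
    change G.potential a b (insert u (insert z _)) x (insert q (insert v (insert y _))) = _ at hpot
    rw [hA, hB] at hpot
    exact (c.potential_le h).trans_eq hpot

end Corner

end Corner

namespace MaxStar

variable [Fintype V]

theorem false_of_le (h : G.MaxStar a b A x B) (hG : G.Counterexample M a b)
    (hx : b x + M x - 1 ≤ G.degIn B x) : False := by
  classical
  obtain ⟨_, _, _, _, _, c⟩ := h.exists_corner hG hx
  exact (c.maxNetPartition hG).false hG

theorem false (h : G.MaxStar a b A x B) (hG : G.Counterexample M a b) : False :=
  (h.le_degIn_right_or_left hG).elim (h.false_of_le hG) (h.symm.false_of_le hG.symm)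

end MaxStar

section Existence

theorem Triple.exists_maxTriple [Finite V] (h : G.Triple a b A x B) :
    ∃ A' x' B', G.MaxTriple a b A' x' B' := by
  obtain ⟨⟨A', x', B'⟩, h', hmax⟩ := Set.exists_max_image
    {t : Finset V × V × Finset V | G.Triple a b t.1 t.2.1 t.2.2}
    (fun t => G.potential a b t.1 t.2.1 t.2.2) (Set.toFinite _) ⟨(A, x, B), h⟩
  exact ⟨A', x', B', h', fun h'' => hmax (_, _, _) h''⟩

theorem Star.exists_maxStar [Finite V] (h : G.Star a b A x B) :
    ∃ A' x' B', G.MaxStar a b A' x' B' := by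
  obtain ⟨⟨A', x', B'⟩, h', hmax⟩ := Set.exists_max_image
    {t : Finset V × V × Finset V | G.Star a b t.1 t.2.1 t.2.2}
    (fun t => (G.low a t.1).card + (G.low b t.2.2).card) (Set.toFinite _) ⟨(A, x, B), h⟩
  exact ⟨A', x', B', h', fun h'' => hmax (_, _, _) h''⟩

variable [Fintype V]

theorem Counterexample.exists_triple [Nonempty V] (hG : G.Counterexample M a b) :
    ∃ A x B, G.Triple a b A x B := by
  classical
  have huniv : Finset.univ ∈ {S | S.Nonempty ∧ G.Feasible a S} :=
    ⟨Finset.univ_nonempty, fun v _ => by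
      linarith [hG.le_degIn_univ v, hG.two_le_right v, hG.one_le_bound v]⟩
  obtain ⟨S, ⟨⟨x, hx⟩, hfeas⟩, hmin⟩ := (Set.toFinite _).exists_minimal ⟨Finset.univ, huniv⟩
  refine ⟨S.erase x, x, Sᶜ, Finset.notMem_erase x S, by simpa using hx, ?_, fun v => ?_, ?_, ?_⟩
  · exact disjoint_compl_right.mono_left (Finset.erase_subset x S)
  · simp only [Finset.mem_erase, Finset.mem_compl]
    tauto
  · intro T hT hne hTfeas
    exact Finset.notMem_erase x S (hT (hmin ⟨hne, hTfeas⟩ (hT.trans (Finset.erase_subset x S)) hx))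
  · intro T hT hne
    exact hG.not_feasible ⟨x, hx⟩ hne (disjoint_compl_right.mono_right hT) hfeas

theorem not_counterexample [Nonempty V] : ¬ G.Counterexample M a b := by
  intro hG
  obtain ⟨_, _, _, htriple⟩ := hG.exists_triple
  obtain ⟨_, _, _, hmax⟩ := htriple.exists_maxTriple
  obtain ⟨_, _, _, hstar⟩ := hmax.exists_star hG
  obtain ⟨_, _, _, hmaxStar⟩ := hstar.exists_maxStar
  exact hmaxStar.false hG

variable [DecidableEq V]

theorem LargeDegrees.exists_feasible_compl_of_disjoint (hG : G.LargeDegrees M a b)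
    (hS : S.Nonempty) (hT : T.Nonempty) (hST : Disjoint S T) (hSa : G.Feasible a S)
    (hTb : G.Feasible b T) :
    ∃ X : Finset V, X.Nonempty ∧ Xᶜ.Nonempty ∧ G.Feasible a X ∧ G.Feasible b Xᶜ := by
  obtain ⟨R, hTR, ⟨hSR, hRb⟩, hmax⟩ :=
    (Set.toFinite {R | Disjoint S R ∧ G.Feasible b R}).exists_le_maximal ⟨hST, hTb⟩
  have hsub : S ⊆ Rᶜ := by rwa [Finset.subset_compl_iff_disjoint_right]
  refine ⟨Rᶜ, hS.mono hsub, by simpa using hT.mono hTR, fun v hv => ?_, by rwa [compl_compl]⟩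
  rw [Finset.mem_compl] at hv
  by_contra! hlt
  have hvS : v ∉ S := fun hvS => hlt.not_ge ((hSa v hvS).trans (degIn_mono hsub v))
  have hdeg : G.degIn R v + G.degIn Rᶜ v = G.degIn Finset.univ v := Finset.sum_add_sum_compl _ _
  have hfeas : G.Feasible b (insert v R) := by
    intro w hw
    rw [degIn_insert hv]
    obtain rfl | hw := Finset.mem_insert.mp hw
    · linarith [hG.le_degIn_univ w, hG.one_le_bound w, G.mult_nonneg w w]
    · linarith [hRb w hw, G.mult_nonneg w v]
  exact hv (hmax ⟨Finset.disjoint_insert_right.mpr ⟨hvS, hSR⟩, hfeas⟩ (Finset.subset_insert v R)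
    (Finset.mem_insert_self v R))

theorem LargeDegrees.exists_feasible_compl [Nonempty V] (hG : G.LargeDegrees M a b)
    (hquads : QuadsEdgeDisjoint G.toSimpleGraph) :
    ∃ X : Finset V, X.Nonempty ∧ Xᶜ.Nonempty ∧ G.Feasible a X ∧ G.Feasible b Xᶜ :=
  by_contra fun h => not_counterexample (G := G) (M := M) (a := a) (b := b)
    ⟨hG, hquads, fun hS hT hST hSa hTb => h
      (hG.exists_feasible_compl_of_disjoint hS hT hST hSa hTb)⟩

end Existence

section OfGraph

variable {α β : Type*} {H : Graph α β}

theorem multiplicity_pos_iff (hE : E(H).Finite) {u v : α} :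
    0 < H.multiplicity u v ↔ H.Adj u v :=
  Set.ncard_pos (hE.subset fun _ he => he.edge_mem)

theorem multiplicity_comm (H : Graph α β) (u v : α) : H.multiplicity u v = H.multiplicity v u := by
  simp only [Graph.multiplicity, H.isLink_comm]

theorem multiplicity_le_weight (hV : V(H).Finite) {u v : α} (hu : u ∈ V(H)) (huv : u ≠ v) :
    H.multiplicity u v ≤ H.weight v :=
  le_csSup ((hV.subset Set.sdiff_subset).image _).bddAbove ⟨u, ⟨hu, huv⟩, rfl⟩

variable [H.Loopless]

theorem graph_degIn_eq_sum (hE : E(H).Finite) (S : Finset α) (v : α) :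
    H.degIn S v = ∑ u ∈ S, H.multiplicity v u := by
  have hunion : {e | ∃ u ∈ (S : Set α) \ {v}, H.IsLink e v u} =
      ⋃ u ∈ (S : Set α), {e | H.IsLink e v u} := by
    ext e
    have hne (u : α) (he : H.IsLink e v u) : u ≠ v := he.adj.ne.symm
    simp only [Set.mem_ofPred_eq, Set.mem_iUnion, Set.mem_sdiff, Set.mem_singleton_iff]
    grind
  rw [Graph.degIn, hunion, S.finite_toSet.ncard_biUnion, finsum_mem_coe_finset]
  · rfl
  · exact fun u _ => hE.subset fun _ he => he.edge_mem
  · exact fun u _ w _ huw => Set.disjoint_left.mpr fun _ he he' => huw (he.right_unique he')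

variable (hE : E(H).Finite)

/-- The multigraph on the vertices of a loopless graph with finitely many edges. -/
noncomputable def ofGraph (H : Graph α β) [H.Loopless] (hE : E(H).Finite) : Multigraph V(H) where
  Adj u v := H.Adj u v
  symm := ⟨fun _ _ h => h.symm⟩
  loopless := ⟨fun _ h => h.ne rfl⟩
  mult u v := H.multiplicity u v
  mult_comm u v := by rw [multiplicity_comm]
  mult_nonneg u v := Int.natCast_nonneg _
  mult_pos_iff := Int.natCast_pos.trans (multiplicity_pos_iff hE)

theorem degIn_ofGraph (S : Finset V(H)) (v : V(H)) :
    (ofGraph H hE).degIn S v = H.degIn (Subtype.val '' (S : Set V(H))) v := by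
  classical
  have himage : Subtype.val '' (S : Set V(H)) = (S.map (.subtype _) : Finset α) := by simp
  rw [himage, graph_degIn_eq_sum hE, Finset.sum_map, Nat.cast_sum]
  rfl

theorem IsQuad.isQuadrilateral {x y z w : V(H)} (h : IsQuad (ofGraph H hE).toSimpleGraph x y z w) :
    H.IsQuadrilateral {s(↑x, ↑y), s(↑y, ↑z), s(↑z, ↑w), s(↑w, ↑x)} := by
  refine ⟨x, y, z, w, ?_, h.adj_xy, h.adj_yz, h.adj_zw, h.adj_wx, rfl⟩
  simp [Subtype.coe_inj, h.adj_xy.ne, h.adj_yz.ne, h.adj_zw.ne, h.adj_wx.ne.symm, h.ne_xz, h.ne_yw]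

theorem quadsEdgeDisjoint_ofGraph (hH : H.QuadrilateralsShareNoEdges) :
    QuadsEdgeDisjoint (ofGraph H hE).toSimpleGraph where
  not_triangle {x y z w t} h hxt hyt := by
    have htriangle : H.IsTriangle {s(↑x, ↑y), s(↑y, ↑t), s(↑t, ↑x)} :=
      ⟨x, y, t, by simp [Subtype.coe_inj, h.adj_xy.ne, hxt.ne, hyt.ne], h.adj_xy, hyt, hxt.symm,
        rfl⟩
    exact Set.disjoint_left.mp ((hH _ h.isQuadrilateral).1 _ htriangle) (Set.mem_insert _ _)
      (Set.mem_insert _ _)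
  unique {x y z w z' w'} h h' := by
    have heq : ({s(↑x, ↑y), s(↑y, ↑z'), s(↑z', ↑w'), s(↑w', ↑x)} : Set (Sym2 α)) =
        {s(↑x, ↑y), s(↑y, ↑z), s(↑z, ↑w), s(↑w, ↑x)} := by
      by_contra hne
      exact Set.disjoint_left.mp ((hH _ h.isQuadrilateral).2 _ h'.isQuadrilateral hne)
        (Set.mem_insert _ _) (Set.mem_insert _ _)
    have hyz : s(↑y, ↑z') ∈ ({s(↑x, ↑y), s(↑y, ↑z), s(↑z, ↑w), s(↑w, ↑x)} : Set (Sym2 α)) :=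
      heq ▸ by simp
    have hwx : s(↑w', ↑x) ∈ ({s(↑x, ↑y), s(↑y, ↑z), s(↑z, ↑w), s(↑w, ↑x)} : Set (Sym2 α)) :=
      heq ▸ by simp
    simp only [Set.mem_insert_iff, Set.mem_singleton_iff, Sym2.eq_iff, Subtype.coe_inj] at hyz hwx
    grind [h.adj_xy.ne, h.adj_yz.ne, h.adj_wx.ne, h.ne_xz, h.ne_yw, h'.ne_xz, h'.ne_yw]

theorem largeDegrees_ofGraph [Fintype V(H)] {a b : α → ℕ} (ha : ∀ v ∈ V(H), 2 ≤ a v)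
    (hb : ∀ v ∈ V(H), 2 ≤ b v)
    (hdeg : ∀ v ∈ V(H), (H.degIn V(H) v : ℤ) ≥ a v + b v + 2 * H.weight v - 3) :
    (ofGraph H hE).LargeDegrees (fun v => H.weight v) (fun v => a v) (fun v => b v) where
  mult_le u v := by
    by_cases huv : u = v
    · rw [huv, mult_self]
      exact Int.natCast_nonneg _
    · rw [mult_comm]
      exact Int.ofNat_le.mpr (multiplicity_le_weight V(H).toFinite v.2
        fun h => huv (Subtype.ext h.symm))
  two_le_left v := Int.ofNat_le.mpr (ha v v.2)
  two_le_right v := Int.ofNat_le.mpr (hb v v.2)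
  le_degIn_univ v := by simpa [degIn_ofGraph] using hdeg v v.2

theorem Feasible.le_degIn_image {a : α → ℕ} {S : Finset V(H)}
    (h : (ofGraph H hE).Feasible (fun v => a v) S) :
    ∀ v ∈ Subtype.val '' (S : Set V(H)), a v ≤ H.degIn (Subtype.val '' (S : Set V(H))) v := by
  rintro _ ⟨v, hv, rfl⟩
  exact Int.ofNat_le.mp ((h v hv).trans_eq (degIn_ofGraph hE S v))

theorem Feasible.isFeasiblePartition [Fintype V(H)] [DecidableEq V(H)] {a b : α → ℕ}
    {X : Finset V(H)} (hX : X.Nonempty) (hX' : Xᶜ.Nonempty)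
    (ha : (ofGraph H hE).Feasible (fun v => a v) X)
    (hb : (ofGraph H hE).Feasible (fun v => b v) Xᶜ) :
    H.IsFeasiblePartition a b (Subtype.val '' (X : Set V(H)))
      (Subtype.val '' ((Xᶜ : Finset V(H)) : Set V(H))) where
  left_nonempty := (Finset.coe_nonempty.mpr hX).image _
  right_nonempty := (Finset.coe_nonempty.mpr hX').image _
  disjoint := by
    rw [Set.disjoint_image_iff Subtype.val_injective, Finset.disjoint_coe]
    exact disjoint_compl_right
  union_eq := by
    rw [← Set.image_union, Finset.coe_compl, Set.union_compl_self, Set.image_univ,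
      Subtype.range_coe]
  left_feasible := ha.le_degIn_image
  right_feasible := hb.le_degIn_image

end OfGraph

end Multigraph

theorem theorem5 {α β : Type*} (G : Graph α β) [G.Loopless]
    (hV : V(G).Finite) (hE : E(G).Finite) (hne : V(G).Nonempty)
    (hG : G.QuadrilateralsShareNoEdges)
    (a b : α → ℕ) (ha : ∀ x ∈ V(G), 2 ≤ a x) (hb : ∀ x ∈ V(G), 2 ≤ b x)
    (hd : ∀ x ∈ V(G), (G.degIn V(G) x : ℤ) ≥ a x + b x + 2 * G.weight x - 3) :
    ∃ X Y : Set α, G.IsFeasiblePartition a b X Y := by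
  classical
  have : Fintype V(G) := hV.fintype
  have : Nonempty V(G) := hne.to_subtype
  have hdegrees := Multigraph.largeDegrees_ofGraph hE ha hb hd
  have hquads := Multigraph.quadsEdgeDisjoint_ofGraph hE hG
  obtain ⟨X, hX, hX', hXa, hXb⟩ := hdegrees.exists_feasible_compl hquads
  exact ⟨_, _, hXa.isFeasiblePartition hE hX hX' hXb⟩
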